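/- **Theorem 4.1.** Let $k$ be an algebraically closed field and, if $\operatorname{char} k\neq 3$, let $\zeta\in k$ be a primitive cube root of unity. Let $x,y\in PSL_2(\mathbb Z)$ be the classes of $\begin{pmatrix}0&-1\\1&0\end{pmatrix}$ and $\begin{pmatrix}0&-1\\1&1\end{pmatrix}$, so that $PSL_2(\mathbb Z)=\langle x,y\mid x^2=y^3=1\rangle$. Call a representation $\rho:PSL_2(\mathbb Z)\to GL_n(k)$ *admissible* if it is irreducible (in particular $n\ge 1$) and maps the commutator subgroup of $PSL_2(\mathbb Z)$ to diagonal matrices. Two pairs $(X,Y)$, $(X',Y')$ of $n\times n$ matrices are *equivalent* if $X'=QXQ^{-1}$ and $Y'=QYQ^{-1}$ for some $Q\in GL_n(k)$. For nonzero $c_1,c_2\in k$ put $$P(c_1,c_2)=\left(\begin{pmatrix}0&1&0&0&0&0\\1&0&0&0&0&0\\0&0&0&1&0&0\\0&0&1&0&0&0\\0&0&0&0&0&1\\0&0&0&0&1&0\end{pmatrix},\begin{pmatrix}0&0&0&0&c_1&0\\0&0&0&0&0&1\\c_2&0&0&0&0&0\\0&1&0&0&0&0\\0&0&\frac1{c_1c_2}&0&0&0\\0&0&0&1&0&0\end{pmatrix}\right),$$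 and put $S=\begin{pmatrix}0&1\\1&0\end{pmatrix}$, $D=\begin{pmatrix}1&0&0\\0&-1&0\\0&0&-1\end{pmatrix}$, $C=\begin{pmatrix}0&1&0\\0&0&1\\1&0&0\end{pmatrix}$. Consider the following lists of pairs. (i) If $\operatorname{char}k\neq 2,3$: - $n=1$: $(1,1),(-1,1),(1,\zeta),(-1,\zeta),(1,\zeta^2),(-1,\zeta^2)$; - $n=2$: $(S,\operatorname{diag}(1,\zeta))$, $(S,\operatorname{diag}(1,\zeta^2))$, $(S,\operatorname{diag}(\zeta,\zeta^2))$; - $n=3$: $(D,C)$, $(-D,C)$; - $n=6$: $P(c_1,c_2)$ with $c_1,c_2\in k\setminus\{0\}$ and $(c_1,c_2)\ne(1,1),(-1,1),(1,-1),(-1,-1),(\zeta,\zeta),(\zeta^2,\zeta^2)$. (ii) If $\operatorname{char}k=2$: - $n=1$: $(1,1),(1,\zeta),(1,\zeta^2)$; - $n=2$: $(S,\operatorname{diag}(1,\zeta))$, $(S,\operatorname{diag}(1,\zeta^2))$, $(S,\operatorname{diag}(\zeta,\zeta^2))$; - $n=6$: $P(c_1,c_2)$ with $c_1,c_2\in k\setminus\{0\}$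 and $(c_1,c_2)\neq(1,1),(\zeta,\zeta),(\zeta^2,\zeta^2)$. (iii) If $\operatorname{char}k=3$: - $n=1$: $(1,1),(-1,1)$; - $n=3$: $(D,C)$, $(-D,C)$; - $n=6$: $P(c_1,c_2)$ with $c_1,c_2\in k\setminus\{0\}$ and $(c_1,c_2)\neq(1,1),(-1,1),(1,-1),(-1,-1)$. In each of the three cases the following hold. 1. If $\rho:PSL_2(\mathbb Z)\to GL_n(k)$ is admissible, then $(\rho(x),\rho(y))$ is equivalent to a pair of size $n$ in the list (in particular $n\in\{1,2,3,6\}$). 2. Every pair $(X,Y)$ in the list equals $(\rho(x),\rho(y))$ for some admissible $\rho$. 3. For each $n<6$, the pairs of size $n$ in the list are pairwise inequivalent. 4. Let $P(c_1,c_2)$ be in the list and let $c_1',c_2'\in k\setminus\{0\}$. Then $P(c_1',c_2')$ is equivalent to $P(c_1,c_2)$ if and only if $(c_1',c_2')$ is one of $$(c_1,c_2),\ \left(\tfrac1{c_1},\tfrac1{c_2}\right),\ \left(c_2,\tfrac1{c_1c_2}\right),\ \left(\tfrac1{c_2},c_1c_2\right),\ \left(\tfrac1{c_1c_2},c_1\right),\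 \left(c_1c_2,\tfrac1{c_1}\right).$$ -/

import Mathlib

open Matrix

/-- The modular group `PSL₂(ℤ)`. -/
abbrev ModGroup : Type := Matrix.ProjectiveSpecialLinearGroup (Fin 2) ℤ

/-- The matrix `[[0, -1], [1, 0]]`. -/
def matX : SpecialLinearGroup (Fin 2) ℤ := ⟨!![0, -1; 1, 0], by simp [Matrix.det_fin_two]⟩

/-- The matrix `[[0, -1], [1, 1]]`. -/
def matY : SpecialLinearGroup (Fin 2) ℤ := ⟨!![0, -1; 1, 1], by simp [Matrix.det_fin_two]⟩

/-- The generator `x` of order two. -/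
def genX : ModGroup := QuotientGroup.mk matX

/-- The generator `y` of order three.  With `genX` it gives the standard presentation
`⟨x, y | x² = y³ = 1⟩` of `PSL₂(ℤ)`. -/
def genY : ModGroup := QuotientGroup.mk matY

section

variable {k : Type*} [Field k]

/-- The linear action on the column space `kⁿ` of a matrix representation. -/
def columnRep {n : ℕ} (ρ : ModGroup →* GL (Fin n) k) : Representation k ModGroup (Fin n → k) :=
  ((Matrix.toLinAlgEquiv' : Matrix (Fin n) (Fin n) k ≃ₐ[k] Module.End k (Fin n → k)) :
      Matrix (Fin n) (Fin n) k →* Module.End k (Fin n → k)).comp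
    ((Units.coeHom (Matrix (Fin n) (Fin n) k)).comp ρ)

/-- `ρ` is irreducible (so `n ≠ 0`) and sends the commutator subgroup to diagonal matrices. -/
def IsIrredDiag {n : ℕ} (ρ : ModGroup →* GL (Fin n) k) : Prop :=
  (columnRep ρ).IsIrreducible ∧
    ∀ g ∈ commutator ModGroup, (ρ g : Matrix (Fin n) (Fin n) k).IsDiag

/-- Pairs of `n × n` matrices over `k`. -/
abbrev MatPair (k : Type*) (n : ℕ) : Type _ :=
  Matrix (Fin n) (Fin n) k × Matrix (Fin n) (Fin n) k

/-- The pair `(ρ(x), ρ(y))`. -/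
def genPair {n : ℕ} (ρ : ModGroup →* GL (Fin n) k) : MatPair k n :=
  ((ρ genX : Matrix (Fin n) (Fin n) k), (ρ genY : Matrix (Fin n) (Fin n) k))

/-- Equivalence of pairs of matrices: simultaneous conjugation. -/
def PairEquiv {n : ℕ} (p q : MatPair k n) : Prop :=
  ∃ Q : GL (Fin n) k,
    p.1 = (Q : Matrix (Fin n) (Fin n) k) * q.1 * ((Q⁻¹ : GL (Fin n) k) : Matrix (Fin n) (Fin n) k) ∧
    p.2 = (Q : Matrix (Fin n) (Fin n) k) * q.2 * ((Q⁻¹ : GL (Fin n) k) : Matrix (Fin n) (Fin n) k)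

/-- The listed pairs of size `n < 6` in characteristic different from `2` and `3`. -/
def smallListGeneric (ζ : k) : (n : ℕ) → List (MatPair k n)
  | 1 => [(!![1], !![1]), (!![-1], !![1]), (!![1], !![ζ]), (!![-1], !![ζ]),
          (!![1], !![ζ ^ 2]), (!![-1], !![ζ ^ 2])]
  | 2 => [(!![0, 1; 1, 0], !![1, 0; 0, ζ]),
          (!![0, 1; 1, 0], !![1, 0; 0, ζ ^ 2]),
          (!![0, 1; 1, 0], !![ζ, 0; 0, ζ ^ 2])]
  | 3 => [(!![1, 0, 0; 0, -1, 0; 0, 0, -1], !![0, 1, 0; 0, 0, 1; 1, 0, 0]),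
          (-!![1, 0, 0; 0, -1, 0; 0, 0, -1], !![0, 1, 0; 0, 0, 1; 1, 0, 0])]
  | _ => []

/-- The listed pairs of size `n < 6` in characteristic `2`. -/
def smallListCharTwo (ζ : k) : (n : ℕ) → List (MatPair k n)
  | 1 => [(!![1], !![1]), (!![1], !![ζ]), (!![1], !![ζ ^ 2])]
  | 2 => [(!![0, 1; 1, 0], !![1, 0; 0, ζ]),
          (!![0, 1; 1, 0], !![1, 0; 0, ζ ^ 2]),
          (!![0, 1; 1, 0], !![ζ, 0; 0, ζ ^ 2])]
  | _ => []

/-- The listed pairs of size `n < 6` in characteristic `3`. -/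
def smallListCharThree : (n : ℕ) → List (MatPair k n)
  | 1 => [(!![1], !![1]), (!![-1], !![1])]
  | 3 => [(!![1, 0, 0; 0, -1, 0; 0, 0, -1], !![0, 1, 0; 0, 0, 1; 1, 0, 0]),
          (-!![1, 0, 0; 0, -1, 0; 0, 0, -1], !![0, 1, 0; 0, 0, 1; 1, 0, 0])]
  | _ => []

/-- The six-dimensional monomial pair with parameters `c₁, c₂`. -/
def sixPair (c₁ c₂ : k) : MatPair k 6 :=
  (!![0, 1, 0, 0, 0, 0;
      1, 0, 0, 0, 0, 0;
      0, 0, 0, 1, 0, 0;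
      0, 0, 1, 0, 0, 0;
      0, 0, 0, 0, 0, 1;
      0, 0, 0, 0, 1, 0],
   !![0, 0, 0, 0, c₁, 0;
      0, 0, 0, 0, 0, 1;
      c₂, 0, 0, 0, 0, 0;
      0, 1, 0, 0, 0, 0;
      0, 0, 1 / (c₁ * c₂), 0, 0, 0;
      0, 0, 0, 1, 0, 0])

/-- The parameters of the six-dimensional family: nonzero, and not one of the excluded pairs. -/
def sixParams (excl : Set (k × k)) : Set (k × k) :=
  {c | c.1 ≠ 0 ∧ c.2 ≠ 0 ∧ c ∉ excl}

/-- The six-dimensional family, as the part of the list in size `n`. -/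
def sixFamily (excl : Set (k × k)) : (n : ℕ) → Set (MatPair k n)
  | 6 => {p | ∃ c ∈ sixParams excl, p = sixPair c.1 c.2}
  | _ => ∅

/-- The six parameter pairs associated with `(c₁, c₂)`. -/
def paramOrbit (c₁ c₂ : k) : Set (k × k) :=
  {(c₁, c₂), (1 / c₁, 1 / c₂), (c₂, 1 / (c₁ * c₂)), (1 / c₂, c₁ * c₂),
    (1 / (c₁ * c₂), c₁), (c₁ * c₂, 1 / c₁)}

/-- The irreducible representations of `PSL₂(ℤ)` that are diagonal on the commutator subgroup are,
up to equivalence, given by the list `small` together with the six-dimensional family with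
excluded parameters `excl`, and the equivalences between members of the list are the stated
ones. -/
structure IsClassification (small : (n : ℕ) → List (MatPair k n)) (excl : Set (k × k)) :
    Prop where
  /-- Every such representation is equivalent to a listed one. -/
  complete : ∀ (n : ℕ) (ρ : ModGroup →* GL (Fin n) k), IsIrredDiag ρ →
    ∃ p : MatPair k n, (p ∈ small n ∨ p ∈ sixFamily excl n) ∧ PairEquiv (genPair ρ) p
  /-- Every listed pair comes from such a representation. -/
  realized : ∀ (n : ℕ) (p : MatPair k n), (p ∈ small n ∨ p ∈ sixFamily excl n) →
    ∃ ρ : ModGroup →* GL (Fin n) k, IsIrredDiag ρ ∧ genPair ρ = p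
  /-- The entries of the list of size `n < 6` are pairwise inequivalent. -/
  small_distinct : ∀ n < 6, (small n).Pairwise fun p q => ¬ PairEquiv p q
  /-- Equivalence within the six-dimensional family. -/
  six_equiv_iff : ∀ c ∈ sixParams excl, ∀ c' : k × k, c'.1 ≠ 0 → c'.2 ≠ 0 →
    (PairEquiv (sixPair c'.1 c'.2) (sixPair c.1 c.2) ↔ c' ∈ paramOrbit c.1 c.2)

end

/-! Write a = xyxy⁻¹ and b = xy⁻¹xy, the commutators of x with y and with y⁻¹. If ρ is admissible,
every standard basis vector v is a common eigenvector of a and b, with eigenvalues c₁ and c₂⁻¹, say.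
Since x² = y³ = 1, the vectors v, yv, y²v, xv, xyv, xy²v are then permuted by x and y up to exactly
the scalars occurring in P(c₁,c₂), so they are the columns of a nonzero intertwiner from P(c₁,c₂) to
ρ (`sixColumns_fst`, `sixColumns_snd`).

In P(c₁,c₂) itself a and b are diagonal. Their joint eigenvalues on the basis form the orbit of the
character (c₁, c₂⁻¹) under the abelianization ℤ/6, and two of them coincide only if the stabilizer
contains the involution (c₁² = c₂² = 1) or an element of order three (c₁ = c₂, c₁³ = 1). Away from
these degenerate parameters a nonzero stable subspace contains a basis vector, hence all of them. So
P(c₁,c₂) is irreducible (`sixPair_isIrredPair`) and Schur's lemma identifies it with ρ. For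
degenerate parameters the relations produce a smaller model: dimension three for signs other than
(1,1), dimension two for a nontrivial cube root of unity, and dimension one for (1,1), where x and y
commute.

The orbit of characters also decides when two six-dimensional pairs are equivalent. The small models
are told apart by traces. Realization rests on the free product structure of PSL₂(ℤ), proved by
ping-pong, and on a grading of each model by a cyclic group, which makes elements of degree zero
diagonal. -/

/-! ### The modular group as a free product. -/

/-- The homomorphism from the cyclic group of order `n` sending the generator to `g`. -/
def cyclicHom {G : Type*} [Group G] (n : ℕ) (g : G) (hg : g ^ n = 1) :
    Multiplicative (ZMod n) →* G :=
  AddMonoidHom.toMultiplicativeLeft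
    (ZMod.lift n ⟨zmultiplesHom (Additive G) (Additive.ofMul g), by
      simp [← ofMul_pow, hg]⟩)

theorem cyclicHom_ofAdd_one {G : Type*} [Group G] (n : ℕ) (g : G) (hg : g ^ n = 1) :
    cyclicHom n g hg (Multiplicative.ofAdd 1) = g := by
  have := ZMod.lift_coe n ⟨zmultiplesHom (Additive G) (Additive.ofMul g), by
      simp [← ofMul_pow, hg]⟩ 1
  simp only [Int.cast_one] at this
  simp [cyclicHom, this]

/-- Central elements are scalars r with r² = 1, so the product of the entries of the first column is
well defined on PSL₂(ℤ), and its sign can serve for ping-pong. -/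
theorem mk_eq_mk_imp_col {M N : SpecialLinearGroup (Fin 2) ℤ}
    (h : (QuotientGroup.mk M : ModGroup) = QuotientGroup.mk N) :
    M 0 0 * M 1 0 = N 0 0 * N 1 0 := by
  rw [QuotientGroup.eq, Matrix.SpecialLinearGroup.mem_center_iff] at h
  obtain ⟨r, hr, hs⟩ := h
  have hN : N.1 = M.1 * (M⁻¹ * N).1 :=
    (congrArg Subtype.val (mul_inv_cancel_left M N)).symm
  have hN : N.1 = M.1 * scalar (Fin 2) r := hN.trans (congrArg (M.1 * ·) hs.symm)
  have h0 : N 0 0 = M 0 0 * r := by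
    refine (congrFun (congrFun hN 0) 0).trans ?_
    rw [scalar_apply, mul_diagonal]
  have h1 : N 1 0 = M 1 0 * r := by
    refine (congrFun (congrFun hN 1) 0).trans ?_
    rw [scalar_apply, mul_diagonal]
  rw [h0, h1]
  simp only [Fintype.card_fin] at hr
  linear_combination (- M 0 0 * M 1 0) * hr

theorem genX_sq : genX ^ 2 = 1 := by
  rw [genX, ← QuotientGroup.mk_pow, QuotientGroup.eq_one_iff,
    Matrix.SpecialLinearGroup.mem_center_iff]
  refine ⟨-1, by simp, ?_⟩
  rw [Matrix.SpecialLinearGroup.coe_pow]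
  ext i j
  fin_cases i <;> fin_cases j <;> simp [matX, pow_two]

theorem genY_cube : genY ^ 3 = 1 := by
  rw [genY, ← QuotientGroup.mk_pow, QuotientGroup.eq_one_iff,
    Matrix.SpecialLinearGroup.mem_center_iff]
  refine ⟨-1, by simp, ?_⟩
  rw [Matrix.SpecialLinearGroup.coe_pow]
  ext i j
  fin_cases i <;> fin_cases j <;> simp [matY, pow_succ]

theorem closure_genX_genY : Subgroup.closure {genX, genY} = ⊤ := by
  have hS : (ModularGroup.S : SpecialLinearGroup (Fin 2) ℤ) = matX := rfl
  have hT : (ModularGroup.T : SpecialLinearGroup (Fin 2) ℤ) = matX⁻¹ * matY := by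
    rw [eq_inv_mul_iff_mul_eq]
    ext i j
    rw [Matrix.SpecialLinearGroup.coe_mul]
    fin_cases i <;> fin_cases j <;>
      simp [ModularGroup.T, matX, matY]
  have h : Subgroup.closure {matX, matY} = ⊤ := by
    rw [eq_top_iff, ← SpecialLinearGroup.SL2Z_generators, Subgroup.closure_le]
    have hx : matX ∈ Subgroup.closure {matX, matY} := Subgroup.subset_closure (by simp)
    have hy : matY ∈ Subgroup.closure {matX, matY} := Subgroup.subset_closure (by simp)
    rintro _ (rfl | rfl)
    · exact hS ▸ hx
    · rw [hT]; exact mul_mem (inv_mem hx) hy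
  have := congrArg (Subgroup.map (QuotientGroup.mk' (Subgroup.center _))) h
  rw [MonoidHom.map_closure, Set.image_pair,
    Subgroup.map_top_of_surjective _ (QuotientGroup.mk'_surjective _)] at this
  exact this

/-- Induction on the generators `x`, `y` of the modular group, without inverses. -/
theorem ModGroup.induction {p : ModGroup → Prop} (one : p 1)
    (genX_mul : ∀ g, p g → p (genX * g)) (genY_mul : ∀ g, p g → p (genY * g))
    (g : ModGroup) : p g := by
  have hX : genX⁻¹ = genX := by rw [inv_eq_iff_mul_eq_one, ← pow_two, genX_sq]
  have hY : genY⁻¹ = genY * genY := by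
    rw [inv_eq_iff_mul_eq_one, ← pow_two, ← pow_succ', genY_cube]
  have hg : g ∈ Subgroup.closure {genX, genY} := closure_genX_genY ▸ Subgroup.mem_top g
  induction hg using Subgroup.closure_induction_left with
  | one => exact one
  | mul_left a ha b _ ih =>
    rcases ha with rfl | rfl
    exacts [genX_mul _ ih, genY_mul _ ih]
  | inv_mul_cancel a ha b _ ih =>
    rcases ha with rfl | rfl
    · rw [hX]; exact genX_mul _ ih
    · rw [hY, mul_assoc]; exact genY_mul _ (genY_mul _ ih)

/-- The cyclic factors, of order `2` and `3`, of the modular group. -/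
abbrev CyclicFactor (i : Fin 2) : Type := Multiplicative (ZMod (i + 2))

/-- The homomorphisms on the cyclic factors given by elements with `a² = b³ = 1`. -/
def factorHom {G : Type*} [Group G] (a b : G) (ha : a ^ 2 = 1) (hb : b ^ 3 = 1) :
    (i : Fin 2) → CyclicFactor i →* G
  | 0 => cyclicHom 2 a ha
  | 1 => cyclicHom 3 b hb

/-- The ping-pong sets: elements whose first column has entries of the prescribed relative
sign. -/
def pingPongSet (i : Fin 2) : Set ModGroup :=
  {g | ∃ M : SpecialLinearGroup (Fin 2) ℤ, QuotientGroup.mk M = g ∧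
    0 < (-1) ^ (i : ℕ) * (M 0 0 * M 1 0)}

theorem pingPongSet_nonempty (i : Fin 2) : (pingPongSet i).Nonempty := by
  fin_cases i
  · exact ⟨_, ⟨!![1, 0; 1, 1], by simp [det_fin_two]⟩, rfl, by simp⟩
  · exact ⟨_, ⟨!![1, 0; -1, 1], by simp [det_fin_two]⟩, rfl, by simp⟩

theorem pingPongSet_disjoint {i j : Fin 2} (h : i ≠ j) :
    Disjoint (pingPongSet i) (pingPongSet j) := by
  rw [Set.disjoint_left]
  rintro _ ⟨M, rfl, hM⟩ ⟨N, hN, hN'⟩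
  have := mk_eq_mk_imp_col hN
  fin_cases i <;> fin_cases j <;> simp at h hM hN' <;> omega

theorem matX_mul_col (M : SpecialLinearGroup (Fin 2) ℤ) :
    (matX * M) 0 0 = -M 1 0 ∧ (matX * M) 1 0 = M 0 0 := by
  rw [Matrix.SpecialLinearGroup.coe_mul]
  simp [matX, Matrix.mul_apply, Fin.sum_univ_two]

theorem matY_mul_col (M : SpecialLinearGroup (Fin 2) ℤ) :
    (matY * M) 0 0 = -M 1 0 ∧ (matY * M) 1 0 = M 0 0 + M 1 0 := by
  rw [Matrix.SpecialLinearGroup.coe_mul]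
  simp [matY, Matrix.mul_apply, Fin.sum_univ_two]

theorem genX_mul_mem {g : ModGroup} (hg : g ∈ pingPongSet 1) : genX * g ∈ pingPongSet 0 := by
  obtain ⟨M, rfl, hM⟩ := hg
  refine ⟨matX * M, rfl, ?_⟩
  rw [(matX_mul_col M).1, (matX_mul_col M).2]
  simp at hM ⊢
  linarith

/-- A first column (a, c) becomes (-c, a + c), with product -(ac + c²). -/
theorem genY_mul_mem {g : ModGroup} (hg : g ∈ pingPongSet 0) : genY * g ∈ pingPongSet 1 := by
  obtain ⟨M, rfl, hM⟩ := hg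
  refine ⟨matY * M, rfl, ?_⟩
  rw [(matY_mul_col M).1, (matY_mul_col M).2]
  simp at hM ⊢
  nlinarith [mul_self_nonneg (M 1 0)]

/-- A first column (a, c) becomes (-(a + c), a), with product -(a² + ac). -/
theorem genY_sq_mul_mem {g : ModGroup} (hg : g ∈ pingPongSet 0) :
    genY * genY * g ∈ pingPongSet 1 := by
  obtain ⟨M, rfl, hM⟩ := hg
  refine ⟨matY * (matY * M), ?_, ?_⟩
  · rw [mul_assoc]; rfl
  rw [(matY_mul_col (matY * M)).1, (matY_mul_col (matY * M)).2, (matY_mul_col M).1, (matY_mul_col M).2]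
  simp at hM ⊢
  nlinarith [mul_self_nonneg (M 0 0)]

theorem lift_factorHom_injective :
    Function.Injective (Monoid.CoprodI.lift (factorHom genX genY genX_sq genY_cube)) := by
  refine Monoid.CoprodI.lift_injective_of_ping_pong _ (Or.inr ⟨1, ?_⟩) pingPongSet
    pingPongSet_nonempty (fun i j h => pingPongSet_disjoint h) ?_
  -- With only two factors, ping-pong requires one of them to have at least three elements; the
  -- factor generated by y does.
  · change 3 ≤ Cardinal.mk (ZMod 3)
    simp [Cardinal.mk_fintype, ZMod.card]
  · intro i j hij h hh
    rintro _ ⟨g, hg, rfl⟩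
    change factorHom genX genY genX_sq genY_cube i h * g ∈ pingPongSet i
    fin_cases i <;> fin_cases j <;> simp at hij
    · have : ∀ h : Multiplicative (ZMod 2), h ≠ 1 → h = Multiplicative.ofAdd 1 := by decide
      obtain rfl := this h hh
      change cyclicHom 2 genX genX_sq _ * g ∈ _
      rw [cyclicHom_ofAdd_one]
      exact genX_mul_mem hg
    · have : ∀ h : Multiplicative (ZMod 3), h ≠ 1 → h = Multiplicative.ofAdd 1 ∨
        h = Multiplicative.ofAdd 1 * Multiplicative.ofAdd 1 := by decide
      change cyclicHom 3 genY genY_cube h * g ∈ _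
      rcases this h hh with rfl | rfl
      · rw [cyclicHom_ofAdd_one]
        exact genY_mul_mem hg
      · rw [map_mul, cyclicHom_ofAdd_one]
        exact genY_sq_mul_mem hg

theorem lift_factorHom_of_zero {G : Type*} [Group G] (a b : G) (ha : a ^ 2 = 1)
    (hb : b ^ 3 = 1) :
    Monoid.CoprodI.lift (factorHom a b ha hb)
      (Monoid.CoprodI.of (i := 0) (Multiplicative.ofAdd 1 : CyclicFactor 0)) = a := by
  rw [Monoid.CoprodI.lift_of]
  exact cyclicHom_ofAdd_one 2 a ha

theorem lift_factorHom_of_one {G : Type*} [Group G] (a b : G) (ha : a ^ 2 = 1)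
    (hb : b ^ 3 = 1) :
    Monoid.CoprodI.lift (factorHom a b ha hb)
      (Monoid.CoprodI.of (i := 1) (Multiplicative.ofAdd 1 : CyclicFactor 1)) = b := by
  rw [Monoid.CoprodI.lift_of]
  exact cyclicHom_ofAdd_one 3 b hb

theorem lift_factorHom_surjective :
    Function.Surjective (Monoid.CoprodI.lift (factorHom genX genY genX_sq genY_cube)) := by
  rw [← MonoidHom.range_eq_top, eq_top_iff, ← closure_genX_genY, Subgroup.closure_le]
  rintro _ (rfl | rfl)
  · exact ⟨_, lift_factorHom_of_zero _ _ _ _⟩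
  · exact ⟨_, lift_factorHom_of_one _ _ _ _⟩

/-- The universal property of `PSL₂(ℤ) = ⟨x, y | x² = y³ = 1⟩`. -/
theorem ModGroup.exists_hom {G : Type*} [Group G] (a b : G) (ha : a ^ 2 = 1) (hb : b ^ 3 = 1) :
    ∃ f : ModGroup →* G, f genX = a ∧ f genY = b := by
  let e := MulEquiv.ofBijective _ ⟨lift_factorHom_injective, lift_factorHom_surjective⟩
  have hx : e.symm genX =
      Monoid.CoprodI.of (i := 0) (Multiplicative.ofAdd 1 : CyclicFactor 0) :=
    e.symm_apply_eq.2 (lift_factorHom_of_zero genX genY genX_sq genY_cube).symm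
  have hy : e.symm genY =
      Monoid.CoprodI.of (i := 1) (Multiplicative.ofAdd 1 : CyclicFactor 1) :=
    e.symm_apply_eq.2 (lift_factorHom_of_one genX genY genX_sq genY_cube).symm
  refine ⟨(Monoid.CoprodI.lift (factorHom a b ha hb)).comp e.symm.toMonoidHom, ?_, ?_⟩
  · change Monoid.CoprodI.lift (factorHom a b ha hb) (e.symm genX) = a
    rw [hx, lift_factorHom_of_zero]
  · change Monoid.CoprodI.lift (factorHom a b ha hb) (e.symm genY) = b
    rw [hy, lift_factorHom_of_one]

/-! ### Irreducible pairs, gradings and Schur's lemma. -/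

section

variable {k : Type*} [Field k]

/-- The column space is nonzero and has no proper nonzero subspace stable under both matrices. -/
def IsIrredPair {n : ℕ} (p : MatPair k n) : Prop :=
  n ≠ 0 ∧ ∀ W : Submodule k (Fin n → k), (∀ w ∈ W, p.1 *ᵥ w ∈ W) → (∀ w ∈ W, p.2 *ᵥ w ∈ W) →
    W = ⊥ ∨ W = ⊤

theorem mulVec_mem_of_genPair_stable {n : ℕ} (ρ : ModGroup →* GL (Fin n) k)
    {W : Submodule k (Fin n → k)} (hX : ∀ w ∈ W, (genPair ρ).1 *ᵥ w ∈ W)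
    (hY : ∀ w ∈ W, (genPair ρ).2 *ᵥ w ∈ W) (g : ModGroup) :
    ∀ w ∈ W, (ρ g : Matrix (Fin n) (Fin n) k) *ᵥ w ∈ W := by
  induction g using ModGroup.induction with
  | one => simp
  | genX_mul g ih =>
    intro w hw
    rw [map_mul, Units.val_mul, ← mulVec_mulVec]
    exact hX _ (ih w hw)
  | genY_mul g ih =>
    intro w hw
    rw [map_mul, Units.val_mul, ← mulVec_mulVec]
    exact hY _ (ih w hw)

theorem columnRep_isIrreducible_iff {n : ℕ} (ρ : ModGroup →* GL (Fin n) k) :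
    (columnRep ρ).IsIrreducible ↔ IsIrredPair (genPair ρ) := by
  constructor
  · intro h
    refine ⟨?_, fun W hX hY => ?_⟩
    · rintro rfl
      obtain ⟨a, b, hab⟩ := h.toNontrivial
      exact hab (Subrepresentation.toSubmodule_injective (Subsingleton.elim _ _))
    · let S : Subrepresentation (columnRep ρ) :=
        ⟨W, fun g w hw => mulVec_mem_of_genPair_stable ρ hX hY g w hw⟩
      rcases h.eq_bot_or_eq_top S with hS | hS
      · exact Or.inl (congrArg Subrepresentation.toSubmodule hS)
      · exact Or.inr (congrArg Subrepresentation.toSubmodule hS)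
  · rintro ⟨hn, h⟩
    have : NeZero n := ⟨hn⟩
    refine { exists_pair_ne := ⟨⊥, ⊤, fun hbt => ?_⟩, eq_bot_or_eq_top := fun S => ?_ }
    · have : (⊥ : Submodule k (Fin n → k)) = ⊤ :=
        congrArg Subrepresentation.toSubmodule hbt
      exact bot_ne_top this
    · rcases h S.toSubmodule (fun w hw => S.apply_mem_toSubmodule genX hw)
        (fun w hw => S.apply_mem_toSubmodule genY hw) with hS | hS
      · exact Or.inl (Subrepresentation.toSubmodule_injective hS)
      · exact Or.inr (Subrepresentation.toSubmodule_injective hS)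

/-- If `x` and `y` are homogeneous for an injective grading of the standard basis by an abelian
group, then the commutator subgroup acts by diagonal matrices. -/
theorem isDiag_of_graded {n : ℕ} {M : Type*} [AddCommGroup M] (ρ : ModGroup →* GL (Fin n) k)
    (l : Fin n → M) (hl : Function.Injective l) (a b : M) (ha : 2 • a = 0) (hb : 3 • b = 0)
    (hX : ∀ i j, (genPair ρ).1 i j ≠ 0 → l i = l j + a)
    (hY : ∀ i j, (genPair ρ).2 i j ≠ 0 → l i = l j + b) :
    ∀ g ∈ commutator ModGroup, (ρ g : Matrix (Fin n) (Fin n) k).IsDiag := by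
  -- The degree homomorphism: `ρ g` shifts degrees by `φ g`, and `φ` kills commutators because its
  -- target is abelian.
  obtain ⟨φ, hφX, hφY⟩ := ModGroup.exists_hom (Multiplicative.ofAdd a) (Multiplicative.ofAdd b)
    (by rw [← ofAdd_nsmul, ha, ofAdd_zero]) (by rw [← ofAdd_nsmul, hb, ofAdd_zero])
  have key : ∀ g i j, (ρ g : Matrix (Fin n) (Fin n) k) i j ≠ 0 →
      l i = l j + Multiplicative.toAdd (φ g) := by
    intro g
    induction g using ModGroup.induction with
    | one =>
      intro i j hij
      have : i = j := by
        by_contra h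
        simp [h] at hij
      simp [this]
    | genX_mul g ih =>
      intro i j hij
      rw [map_mul, Units.val_mul, Matrix.mul_apply] at hij
      obtain ⟨m, -, hm⟩ := Finset.exists_ne_zero_of_sum_ne_zero hij
      rw [hX i m (left_ne_zero_of_mul hm), ih m j (right_ne_zero_of_mul hm), map_mul, hφX,
        toAdd_mul, toAdd_ofAdd]
      abel
    | genY_mul g ih =>
      intro i j hij
      rw [map_mul, Units.val_mul, Matrix.mul_apply] at hij
      obtain ⟨m, -, hm⟩ := Finset.exists_ne_zero_of_sum_ne_zero hij
      rw [hY i m (left_ne_zero_of_mul hm), ih m j (right_ne_zero_of_mul hm), map_mul, hφY,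
        toAdd_mul, toAdd_ofAdd]
      abel
  intro g hg i j hij
  by_contra h
  have hg1 : φ g = 1 := Abelianization.commutator_subset_ker φ hg
  have := key g i j h
  rw [hg1, toAdd_one, add_zero] at this
  exact hij (hl this)

theorem exists_isIrredDiag {n : ℕ} {M : Type*} [AddCommGroup M] {p : MatPair k n}
    (h1 : p.1 * p.1 = 1) (h2 : p.2 * p.2 * p.2 = 1) (hp : IsIrredPair p)
    (l : Fin n → M) (hl : Function.Injective l) (a b : M) (ha : 2 • a = 0) (hb : 3 • b = 0)
    (hX : ∀ i j, p.1 i j ≠ 0 → l i = l j + a) (hY : ∀ i j, p.2 i j ≠ 0 → l i = l j + b) :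
    ∃ ρ : ModGroup →* GL (Fin n) k, IsIrredDiag ρ ∧ genPair ρ = p := by
  let x : GL (Fin n) k := ⟨p.1, p.1, h1, h1⟩
  let y : GL (Fin n) k := ⟨p.2, p.2 * p.2, by rw [← mul_assoc, h2], h2⟩
  obtain ⟨ρ, hx, hy⟩ := ModGroup.exists_hom x y (Units.ext (by simp [x, pow_two, h1]))
    (Units.ext (by simp [y, pow_succ, h2]))
  have hρ : genPair ρ = p := by
    rw [genPair, hx, hy]
  refine ⟨ρ, ⟨?_, ?_⟩, hρ⟩
  · rw [columnRep_isIrreducible_iff, hρ]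
    exact hp
  · subst hρ
    exact isDiag_of_graded ρ l hl a b ha hb hX hY

/-- A nonzero subspace stable under diagonal matrices that separate the indices contains a
standard basis vector. -/
theorem exists_single_mem {n : ℕ} {W : Submodule k (Fin n → k)} (hW : W ≠ ⊥)
    (h : ∀ i j, i ≠ j → ∃ d : Fin n → k, d i ≠ d j ∧ ∀ w ∈ W, d * w ∈ W) :
    ∃ i, Pi.single i 1 ∈ W := by
  obtain ⟨w, hw, hw0⟩ := W.exists_mem_ne_zero_of_ne_bot hW
  obtain ⟨i, hi⟩ := Function.ne_iff.1 hw0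
  -- Coordinates other than i are killed one at a time: d * u - d j • u vanishes at j and multiplies
  -- coordinate i by d i - d j ≠ 0.
  have key : ∀ s : Finset (Fin n), i ∉ s → ∃ u ∈ W, u i ≠ 0 ∧ ∀ j ∈ s, u j = 0 := by
    intro s
    induction s using Finset.induction_on with
    | empty => exact fun _ => ⟨w, hw, hi, by simp⟩
    | insert j s hj ih =>
      intro his
      rw [Finset.mem_insert, not_or] at his
      obtain ⟨u, hu, hui, hus⟩ := ih his.2
      obtain ⟨d, hd, hdW⟩ := h i j his.1
      refine ⟨d * u - d j • u, W.sub_mem (hdW u hu) (W.smul_mem _ hu), ?_, ?_⟩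
      · simpa [← sub_mul, sub_eq_zero, hd] using hui
      · intro m hm
        rcases Finset.mem_insert.1 hm with rfl | hm
        · simp
        · simp [hus m hm]
  obtain ⟨u, hu, hui, hus⟩ := key (Finset.univ.erase i) (by simp)
  refine ⟨i, ?_⟩
  have : Pi.single i (1 : k) = (u i)⁻¹ • u := by
    ext j
    by_cases hj : j = i
    · subst hj
      simp [inv_mul_cancel₀ hui]
    · simp [hj, hus j (by simp [hj])]
  rw [this]
  exact W.smul_mem _ hu

theorem eq_top_of_single_mem {n : ℕ} {W : Submodule k (Fin n → k)}
    (h : ∀ i, Pi.single i (1 : k) ∈ W) : W = ⊤ := by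
  rw [eq_top_iff]
  intro w _
  rw [pi_eq_sum_univ' w]
  exact W.sum_mem fun i _ => W.smul_mem _ (h i)

/-- A nonzero intertwiner from a pair of size at most `n` to an irreducible pair of size `n` is
an equivalence. -/
theorem pairEquiv_of_intertwiner_of_le {n m : ℕ} {p : MatPair k n} {q : MatPair k m}
    (hp : IsIrredPair p) (hmn : m ≤ n) (B : Matrix (Fin n) (Fin m) k) (hB : B ≠ 0)
    (h1 : p.1 * B = B * q.1) (h2 : p.2 * B = B * q.2) :
    ∃ h : m = n, PairEquiv p (h ▸ q) := by
  -- The range is a nonzero stable subspace of an irreducible target, hence everything;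
  -- irreducibility of `q` is not needed once its size is bounded by n.
  have htop : LinearMap.range B.mulVecLin = ⊤ := by
    refine (hp.2 _ ?_ ?_).resolve_left ?_
    · rintro _ ⟨u, rfl⟩
      exact ⟨q.1 *ᵥ u, by simp [h1]⟩
    · rintro _ ⟨u, rfl⟩
      exact ⟨q.2 *ᵥ u, by simp [h2]⟩
    · rw [LinearMap.range_eq_bot]
      intro h
      exact hB (Matrix.mulVec_injective (funext fun v => by simpa using LinearMap.congr_fun h v))
  have hnm : n ≤ m := by
    simpa using LinearMap.finrank_le_finrank_of_surjective (LinearMap.range_eq_top.1 htop)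
  obtain rfl : m = n := le_antisymm hmn hnm
  refine ⟨rfl, ?_⟩
  have hU : IsUnit B := Matrix.mulVec_surjective_iff_isUnit.1 (LinearMap.range_eq_top.1 htop)
  obtain ⟨Q, rfl⟩ := hU
  refine ⟨Q, ?_, ?_⟩
  · exact (Units.eq_mul_inv_iff_mul_eq Q).2 h1
  · exact (Units.eq_mul_inv_iff_mul_eq Q).2 h2

/-- Schur's lemma: a nonzero intertwiner between irreducible pairs is an equivalence. -/
theorem pairEquiv_of_intertwiner {n m : ℕ} {p : MatPair k n} {q : MatPair k m}
    (hp : IsIrredPair p) (hq : IsIrredPair q) (B : Matrix (Fin n) (Fin m) k) (hB : B ≠ 0)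
    (h1 : p.1 * B = B * q.1) (h2 : p.2 * B = B * q.2) :
    ∃ h : m = n, PairEquiv p (h ▸ q) := by
  refine pairEquiv_of_intertwiner_of_le hp ?_ B hB h1 h2
  have hker : LinearMap.ker B.mulVecLin = ⊥ := by
    refine (hq.2 _ ?_ ?_).resolve_right ?_
    · intro u hu
      simp only [LinearMap.mem_ker, mulVecLin_apply] at hu ⊢
      rw [mulVec_mulVec, ← h1, ← mulVec_mulVec, hu, mulVec_zero]
    · intro u hu
      simp only [LinearMap.mem_ker, mulVecLin_apply] at hu ⊢
      rw [mulVec_mulVec, ← h2, ← mulVec_mulVec, hu, mulVec_zero]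
    · rw [LinearMap.ker_eq_top]
      intro h
      exact hB (Matrix.mulVec_injective (funext fun v => by simpa using LinearMap.congr_fun h v))
  simpa using LinearMap.finrank_le_finrank_of_injective (LinearMap.ker_eq_bot.1 hker)

/-- The matrix with columns `b j` intertwines pairs as soon as it does so on columns. -/
theorem mul_of_columns {n m : ℕ} {X : Matrix (Fin n) (Fin n) k} {M : Matrix (Fin m) (Fin m) k}
    {b : Fin m → Fin n → k} (h : ∀ j, X *ᵥ b j = ∑ i, M i j • b i) :
    X * (Matrix.of b)ᵀ = (Matrix.of b)ᵀ * M := by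
  ext i j
  have := congrFun (h j) i
  simpa [Matrix.mul_apply, mulVec, dotProduct, mul_comm] using this

theorem of_columns_ne_zero {n m : ℕ} {b : Fin m → Fin n → k} {j : Fin m} (h : b j ≠ 0) :
    (Matrix.of b)ᵀ ≠ 0 := by
  intro h0
  apply h
  ext i
  exact congrFun (congrFun h0 i) j

/-! ### The model pairs and their irreducibility. -/

/-- The scalar pairs. -/
def onePair (d e : k) : MatPair k 1 := (!![d], !![e])

/-- The two-dimensional pairs with swap matrix and diagonal matrix. -/
def twoPair (a b : k) : MatPair k 2 := (!![0, 1; 1, 0], !![a, 0; 0, b])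

/-- The three-dimensional pairs. -/
def threePair (δ : k) : MatPair k 3 :=
  (!![δ, 0, 0; 0, -δ, 0; 0, 0, -δ], !![0, 1, 0; 0, 0, 1; 1, 0, 0])

/-- The parameters for which the six-dimensional pair is reducible. -/
def IsDegenerate (c₁ c₂ : k) : Prop :=
  (c₁ ^ 2 = 1 ∧ c₂ ^ 2 = 1) ∨ (c₁ = c₂ ∧ c₁ ^ 3 = 1)

theorem onePair_isIrredPair (d e : k) : IsIrredPair (onePair d e) := by
  refine ⟨one_ne_zero, fun W _ _ => ?_⟩
  by_contra! h
  obtain ⟨i, hi⟩ := exists_single_mem h.1 (fun i j hij => absurd (Subsingleton.elim i j) hij)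
  exact h.2 (eq_top_of_single_mem fun j => Subsingleton.elim i j ▸ hi)

theorem twoPair_fst_mulVec (a b : k) (w : Fin 2 → k) :
    (twoPair a b).1 *ᵥ w = ![w 1, w 0] := by
  ext i; fin_cases i <;> simp [twoPair, mulVec, dotProduct, Fin.sum_univ_succ]

theorem twoPair_snd_mulVec (a b : k) (w : Fin 2 → k) :
    (twoPair a b).2 *ᵥ w = ![a, b] * w := by
  ext i; fin_cases i <;> simp [twoPair, mulVec, dotProduct, Fin.sum_univ_succ]

theorem twoPair_isIrredPair {a b : k} (h : a ≠ b) : IsIrredPair (twoPair a b) := by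
  refine ⟨two_ne_zero, fun W hX hY => ?_⟩
  by_contra! hW
  obtain ⟨i, hi⟩ := exists_single_mem hW.1 (fun i j hij => ⟨![a, b], by
    fin_cases i <;> fin_cases j <;> simp_all [h.symm], fun w hw => by
      rw [← twoPair_snd_mulVec]; exact hY w hw⟩)
  refine hW.2 (eq_top_of_single_mem fun j => ?_)
  have hi' := hX _ hi
  rw [twoPair_fst_mulVec] at hi'
  by_cases hij : j = i
  · exact hij ▸ hi
  · convert hi' using 1
    ext m
    fin_cases i <;> fin_cases j <;> fin_cases m <;> simp_all

theorem threePair_fst_mulVec (δ : k) (w : Fin 3 → k) :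
    (threePair δ).1 *ᵥ w = ![δ, -δ, -δ] * w := by
  ext i; fin_cases i <;> simp [threePair, mulVec, dotProduct, Fin.sum_univ_succ]

theorem threePair_snd_mulVec (δ : k) (w : Fin 3 → k) :
    (threePair δ).2 *ᵥ w = ![w 1, w 2, w 0] := by
  ext i; fin_cases i <;> simp [threePair, mulVec, dotProduct, Fin.sum_univ_succ]

theorem threePair_isIrredPair {δ : k} (h : δ ≠ -δ) : IsIrredPair (threePair δ) := by
  refine ⟨three_ne_zero, fun W hX hY => ?_⟩
  by_contra! hW
  have h0 : ∀ w ∈ W, ![δ, -δ, -δ] * w ∈ W := fun w hw => by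
    rw [← threePair_fst_mulVec]; exact hX w hw
  -- This diagonal matrix is y⁻¹xy. Together with x, which isolates the index 0, it separates all
  -- three indices.
  have h1 : ∀ w ∈ W, ![-δ, δ, -δ] * w ∈ W := fun w hw => by
    have := hY _ (hY _ (h0 _ (hY w hw)))
    simp only [threePair_snd_mulVec] at this
    convert this using 1
    ext i; fin_cases i <;> simp
  obtain ⟨i, hi⟩ := exists_single_mem hW.1 (fun i j hij => by
    by_cases h01 : i = 0 ∨ j = 0
    · exact ⟨_, by fin_cases i <;> fin_cases j <;> simp_all [h.symm], h0⟩
    · exact ⟨_, by fin_cases i <;> fin_cases j <;> simp_all [h.symm], h1⟩)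
  refine hW.2 (eq_top_of_single_mem fun j => ?_)
  have hi1 := hY _ hi
  have hi2 := hY _ hi1
  simp only [threePair_snd_mulVec] at hi1 hi2
  have : (Pi.single j 1 : Fin 3 → k) = Pi.single i 1 ∨
      (Pi.single j 1 : Fin 3 → k) = ![(Pi.single i 1 : Fin 3 → k) 1, (Pi.single i 1 : Fin 3 → k) 2,
        (Pi.single i 1 : Fin 3 → k) 0] ∨
      (Pi.single j 1 : Fin 3 → k) = ![(Pi.single i 1 : Fin 3 → k) 2, (Pi.single i 1 : Fin 3 → k) 0,
        (Pi.single i 1 : Fin 3 → k) 1] := by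
    fin_cases i <;> fin_cases j <;> simp [funext_iff, Fin.forall_fin_succ]
  rcases this with h | h | h <;> rw [h]
  exacts [hi, hi1, hi2]

theorem sixPair_fst_mulVec (c₁ c₂ : k) (w : Fin 6 → k) :
    (sixPair c₁ c₂).1 *ᵥ w = ![w 1, w 0, w 3, w 2, w 5, w 4] := by
  ext i; fin_cases i <;> simp [sixPair, mulVec, dotProduct, Fin.sum_univ_succ]

theorem sixPair_snd_mulVec (c₁ c₂ : k) (w : Fin 6 → k) :
    (sixPair c₁ c₂).2 *ᵥ w =
      ![c₁ * w 4, w 5, c₂ * w 0, w 1, 1 / (c₁ * c₂) * w 2, w 3] := by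
  ext i; fin_cases i <;> simp [sixPair, mulVec, dotProduct, Fin.sum_univ_succ]

/-- The commutator `x y x y⁻¹` acts diagonally on the six-dimensional pair. -/
theorem sixPair_commutator_fst {c₁ c₂ : k} (h₁ : c₁ ≠ 0) (h₂ : c₂ ≠ 0) (w : Fin 6 → k) :
    (sixPair c₁ c₂).1 *ᵥ (sixPair c₁ c₂).2 *ᵥ (sixPair c₁ c₂).1 *ᵥ (sixPair c₁ c₂).2 *ᵥ
      (sixPair c₁ c₂).2 *ᵥ w =
    ![1 / c₁, c₁, 1 / c₂, c₂, c₁ * c₂, 1 / (c₁ * c₂)] * w := by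
  simp only [sixPair_fst_mulVec, sixPair_snd_mulVec]
  ext i; fin_cases i <;> simp <;> field_simp

/-- The commutator `x y⁻¹ x y` acts diagonally on the six-dimensional pair. -/
theorem sixPair_commutator_snd {c₁ c₂ : k} (h₁ : c₁ ≠ 0) (h₂ : c₂ ≠ 0) (w : Fin 6 → k) :
    (sixPair c₁ c₂).1 *ᵥ (sixPair c₁ c₂).2 *ᵥ (sixPair c₁ c₂).2 *ᵥ (sixPair c₁ c₂).1 *ᵥ
      (sixPair c₁ c₂).2 *ᵥ w =
    ![c₂, 1 / c₂, 1 / (c₁ * c₂), c₁ * c₂, c₁, 1 / c₁] * w := by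
  simp only [sixPair_fst_mulVec, sixPair_snd_mulVec]
  ext i; fin_cases i <;> simp <;> field_simp

/-- The six joint eigenvalues form one orbit of ℤ/6: x inverts both entries and y cycles three
characters. A coincidence gives a nontrivial stabilizer, which contains the element of order two or
those of order three; these are the two alternatives in `IsDegenerate`. -/
theorem characters_separate {c₁ c₂ : k} (h₁ : c₁ ≠ 0) (h₂ : c₂ ≠ 0) (h : ¬ IsDegenerate c₁ c₂)
    {i j : Fin 6} (hij : i ≠ j) :
    ![1 / c₁, c₁, 1 / c₂, c₂, c₁ * c₂, 1 / (c₁ * c₂)] i ≠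
        ![1 / c₁, c₁, 1 / c₂, c₂, c₁ * c₂, 1 / (c₁ * c₂)] j ∨
      ![c₂, 1 / c₂, 1 / (c₁ * c₂), c₁ * c₂, c₁, 1 / c₁] i ≠
        ![c₂, 1 / c₂, 1 / (c₁ * c₂), c₁ * c₂, c₁, 1 / c₁] j := by
  contrapose! h
  obtain ⟨ha, hb⟩ := h
  unfold IsDegenerate
  fin_cases i <;> fin_cases j <;> simp at hij ha hb ⊢ <;> (try field_simp at ha) <;>
    (try field_simp at hb) <;> grind

theorem sixPair_isIrredPair {c₁ c₂ : k} (h₁ : c₁ ≠ 0) (h₂ : c₂ ≠ 0)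
    (h : ¬ IsDegenerate c₁ c₂) : IsIrredPair (sixPair c₁ c₂) := by
  refine ⟨by norm_num, fun W hX hY => ?_⟩
  by_contra! hW
  obtain ⟨i, hi⟩ := exists_single_mem hW.1 (fun i j hij => by
    rcases characters_separate h₁ h₂ h hij with hd | hd
    · exact ⟨_, hd, fun w hw => by
        rw [← sixPair_commutator_fst h₁ h₂]
        exact hX _ (hY _ (hX _ (hY _ (hY _ hw))))⟩
    · exact ⟨_, hd, fun w hw => by
        rw [← sixPair_commutator_snd h₁ h₂]
        exact hX _ (hY _ (hY _ (hX _ (hY _ hw))))⟩)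
  -- It remains to see that x and y permute the six coordinate lines transitively.
  have hX' : ∀ a b : Fin 6, (∀ m, ![(Pi.single a 1 : Fin 6 → k) 1, (Pi.single a 1 : Fin 6 → k) 0,
      (Pi.single a 1 : Fin 6 → k) 3, (Pi.single a 1 : Fin 6 → k) 2, (Pi.single a 1 : Fin 6 → k) 5,
      (Pi.single a 1 : Fin 6 → k) 4] m = (Pi.single b 1 : Fin 6 → k) m) →
      Pi.single a (1 : k) ∈ W → Pi.single b (1 : k) ∈ W := by
    intro a b hab ha
    have := hX _ ha
    rwa [sixPair_fst_mulVec, funext hab] at this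
  have hY' : ∀ (a b : Fin 6) (t : k), t ≠ 0 → (∀ m, ![c₁ * (Pi.single a 1 : Fin 6 → k) 4,
      (Pi.single a 1 : Fin 6 → k) 5, c₂ * (Pi.single a 1 : Fin 6 → k) 0,
      (Pi.single a 1 : Fin 6 → k) 1, 1 / (c₁ * c₂) * (Pi.single a 1 : Fin 6 → k) 2,
      (Pi.single a 1 : Fin 6 → k) 3] m = (t • Pi.single b 1 : Fin 6 → k) m) →
      Pi.single a (1 : k) ∈ W → Pi.single b (1 : k) ∈ W := by
    intro a b t ht hab ha
    have := hY _ ha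
    rw [sixPair_snd_mulVec, funext hab] at this
    exact (W.smul_mem_iff ht).1 this
  have X01 := hX' 0 1 (by simp [Fin.forall_fin_succ])
  have X10 := hX' 1 0 (by simp [Fin.forall_fin_succ])
  have X23 := hX' 2 3 (by simp [Fin.forall_fin_succ])
  have X32 := hX' 3 2 (by simp [Fin.forall_fin_succ])
  have X45 := hX' 4 5 (by simp [Fin.forall_fin_succ])
  have X54 := hX' 5 4 (by simp [Fin.forall_fin_succ])
  have Y02 := hY' 0 2 c₂ h₂ (by simp [Fin.forall_fin_succ])
  have Y24 := hY' 2 4 (1 / (c₁ * c₂)) (by simp [h₁, h₂]) (by simp [Fin.forall_fin_succ])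
  have Y40 := hY' 4 0 c₁ h₁ (by simp [Fin.forall_fin_succ])
  refine hW.2 (eq_top_of_single_mem fun j => ?_)
  have h0 : Pi.single (0 : Fin 6) (1 : k) ∈ W := by
    fin_cases i
    exacts [hi, X10 hi, Y40 (Y24 hi), Y40 (Y24 (X32 hi)), Y40 hi, Y40 (X54 hi)]
  fin_cases j
  exacts [h0, X01 h0, Y02 h0, X23 (Y02 h0), Y24 (Y02 h0), X45 (Y24 (Y02 h0))]

/-! ### Realizing the model pairs. -/

theorem onePair_realized {d e : k} (hd : d ^ 2 = 1) (he : e ^ 3 = 1) :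
    ∃ ρ : ModGroup →* GL (Fin 1) k, IsIrredDiag ρ ∧ genPair ρ = onePair d e := by
  refine exists_isIrredDiag (M := ZMod 1) ?_ ?_ (onePair_isIrredPair d e) (fun _ => 0)
    (Function.injective_of_subsingleton _) 0 0 (by simp) (by simp) (by simp) (by simp)
  · ext i j; fin_cases i; fin_cases j; simpa [onePair, pow_two] using hd
  · ext i j; fin_cases i; fin_cases j; simpa [onePair, pow_succ] using he

theorem twoPair_realized {a b : k} (ha : a ^ 3 = 1) (hb : b ^ 3 = 1) (hab : a ≠ b) :
    ∃ ρ : ModGroup →* GL (Fin 2) k, IsIrredDiag ρ ∧ genPair ρ = twoPair a b := by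
  refine exists_isIrredDiag (M := ZMod 2) ?_ ?_ (twoPair_isIrredPair hab) ![0, 1]
    (by decide) 1 0 (by decide) (by decide) ?_ ?_
  · refine Matrix.mulVec_injective (funext fun w => ?_)
    simp only [← mulVec_mulVec, twoPair_fst_mulVec]
    ext i; fin_cases i <;> simp
  · refine Matrix.mulVec_injective (funext fun w => ?_)
    simp only [← mulVec_mulVec, twoPair_snd_mulVec]
    ext i; fin_cases i <;> simp
    · linear_combination w 0 * ha
    · linear_combination w 1 * hb
  · intro i j; fin_cases i <;> fin_cases j <;> simp [twoPair] <;> decide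
  · intro i j; fin_cases i <;> fin_cases j <;> simp [twoPair]

theorem threePair_realized {δ : k} (hδ : δ ^ 2 = 1) (h : δ ≠ -δ) :
    ∃ ρ : ModGroup →* GL (Fin 3) k, IsIrredDiag ρ ∧ genPair ρ = threePair δ := by
  refine exists_isIrredDiag (M := ZMod 3) ?_ ?_ (threePair_isIrredPair h) ![0, 1, 2]
    (by decide) 0 2 (by decide) (by decide) ?_ ?_
  · refine Matrix.mulVec_injective (funext fun w => ?_)
    simp only [← mulVec_mulVec, threePair_fst_mulVec]
    ext i; fin_cases i <;> simp [← mul_assoc, ← pow_two, hδ]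
  · refine Matrix.mulVec_injective (funext fun w => ?_)
    simp only [← mulVec_mulVec, threePair_snd_mulVec]
    ext i; fin_cases i <;> simp
  · intro i j; fin_cases i <;> fin_cases j <;> simp [threePair]
  · intro i j; fin_cases i <;> fin_cases j <;> simp [threePair] <;> decide

theorem sixPair_fst_sq (c₁ c₂ : k) : (sixPair c₁ c₂).1 * (sixPair c₁ c₂).1 = 1 := by
  refine Matrix.mulVec_injective (funext fun w => ?_)
  simp only [← mulVec_mulVec, sixPair_fst_mulVec]
  ext i; fin_cases i <;> simp

theorem sixPair_snd_cube {c₁ c₂ : k} (h₁ : c₁ ≠ 0) (h₂ : c₂ ≠ 0) :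
    (sixPair c₁ c₂).2 * (sixPair c₁ c₂).2 * (sixPair c₁ c₂).2 = 1 := by
  refine Matrix.mulVec_injective (funext fun w => ?_)
  simp only [← mulVec_mulVec, sixPair_snd_mulVec]
  ext i; fin_cases i <;> simp <;> field_simp

theorem sixPair_realized {c₁ c₂ : k} (h₁ : c₁ ≠ 0) (h₂ : c₂ ≠ 0) (h : ¬ IsDegenerate c₁ c₂) :
    ∃ ρ : ModGroup →* GL (Fin 6) k, IsIrredDiag ρ ∧ genPair ρ = sixPair c₁ c₂ := by
  refine exists_isIrredDiag (M := ZMod 6) (sixPair_fst_sq c₁ c₂) (sixPair_snd_cube h₁ h₂)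
    -- With x of degree 3, y of degree 4 and v of degree 0, these are the degrees mod 6 of xv, v,
    -- xyv, yv, xy²v, y²v.
    (sixPair_isIrredPair h₁ h₂ h) ![3, 0, 1, 4, 5, 2]
    (by decide) 3 4 (by decide) (by decide) ?_ ?_
  · intro i j; fin_cases i <;> fin_cases j <;> simp [sixPair] <;> decide
  · intro i j; fin_cases i <;> fin_cases j <;> simp [sixPair] <;> intros <;> decide

/-! ### From a commutator eigenvector to a model pair. -/

theorem pairEquiv_onePair {n : ℕ} {p : MatPair k n} (hp : IsIrredPair p) {w : Fin n → k}
    (hw : w ≠ 0) {d e : k} (h1 : p.1 *ᵥ w = d • w) (h2 : p.2 *ᵥ w = e • w) :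
    ∃ h : 1 = n, PairEquiv p (h ▸ onePair d e) := by
  refine pairEquiv_of_intertwiner hp (onePair_isIrredPair d e) (Matrix.of ![w])ᵀ
    (of_columns_ne_zero (j := 0) hw) (mul_of_columns fun j => ?_) (mul_of_columns fun j => ?_)
  · fin_cases j; simpa [onePair] using h1
  · fin_cases j; simpa [onePair] using h2

theorem pairEquiv_twoPair {n : ℕ} {p : MatPair k n} (hp : IsIrredPair p)
    (hX : ∀ w, p.1 *ᵥ p.1 *ᵥ w = w) {w : Fin n → k} (hw : w ≠ 0) {a b : k} (hab : a ≠ b)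
    (h1 : p.2 *ᵥ w = a • w) (h2 : p.2 *ᵥ p.1 *ᵥ w = b • p.1 *ᵥ w) :
    ∃ h : 2 = n, PairEquiv p (h ▸ twoPair a b) := by
  refine pairEquiv_of_intertwiner hp (twoPair_isIrredPair hab) (Matrix.of ![w, p.1 *ᵥ w])ᵀ
    (of_columns_ne_zero (j := 0) hw) (mul_of_columns fun j => ?_) (mul_of_columns fun j => ?_)
  · fin_cases j <;> simp [twoPair, hX]
  · fin_cases j <;> simp [twoPair, h1, h2]

theorem pairEquiv_threePair {n : ℕ} {p : MatPair k n} (hp : IsIrredPair p)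
    (hY : ∀ w, p.2 *ᵥ p.2 *ᵥ p.2 *ᵥ w = w) {w : Fin n → k} (hw : w ≠ 0) {δ : k} (hδ : δ ≠ -δ)
    (h0 : p.1 *ᵥ w = δ • w) (h1 : p.1 *ᵥ p.2 *ᵥ w = -δ • p.2 *ᵥ w)
    (h2 : p.1 *ᵥ p.2 *ᵥ p.2 *ᵥ w = -δ • p.2 *ᵥ p.2 *ᵥ w) :
    ∃ h : 3 = n, PairEquiv p (h ▸ threePair δ) := by
  refine pairEquiv_of_intertwiner hp (threePair_isIrredPair hδ)
    (Matrix.of ![w, p.2 *ᵥ p.2 *ᵥ w, p.2 *ᵥ w])ᵀ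
    (of_columns_ne_zero (j := 0) hw) (mul_of_columns fun j => ?_) (mul_of_columns fun j => ?_)
  · fin_cases j <;> simp [threePair, h0, h1, h2, -mulVec_mulVec, Fin.sum_univ_succ]
  · fin_cases j <;> simp [threePair, hY, -mulVec_mulVec, Fin.sum_univ_succ]

/-- `v` is an eigenvector of the commutators `x y x y⁻¹` and `x y⁻¹ x y` with eigenvalues `c₁` and
`c₂⁻¹`. -/
structure IsCommutatorEigenvector {n : ℕ} (p : MatPair k n) (c₁ c₂ : k) (v : Fin n → k) :
    Prop where
  fst : p.1 *ᵥ p.2 *ᵥ p.1 *ᵥ p.2 *ᵥ p.2 *ᵥ v = c₁ • v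
  snd : p.1 *ᵥ p.2 *ᵥ p.2 *ᵥ p.1 *ᵥ p.2 *ᵥ v = c₂⁻¹ • v

section

variable {n : ℕ} {p : MatPair k n} {c₁ c₂ : k} {v : Fin n → k}

theorem IsCommutatorEigenvector.snd_fst_sq (h : IsCommutatorEigenvector p c₁ c₂ v)
    (hX : ∀ w, p.1 *ᵥ p.1 *ᵥ w = w) :
    p.2 *ᵥ p.1 *ᵥ p.2 *ᵥ p.2 *ᵥ v = c₁ • p.1 *ᵥ v := by
  rw [← mulVec_smul, ← h.fst, hX]

theorem IsCommutatorEigenvector.snd_fst (h : IsCommutatorEigenvector p c₁ c₂ v) (h₂ : c₂ ≠ 0)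
    (hX : ∀ w, p.1 *ᵥ p.1 *ᵥ w = w) (hY : ∀ w, p.2 *ᵥ p.2 *ᵥ p.2 *ᵥ w = w) :
    p.2 *ᵥ p.1 *ᵥ v = c₂ • p.1 *ᵥ p.2 *ᵥ v := by
  have : v = c₂ • p.1 *ᵥ p.2 *ᵥ p.2 *ᵥ p.1 *ᵥ p.2 *ᵥ v := by
    rw [h.snd, smul_inv_smul₀ h₂]
  conv_lhs => rw [this]
  rw [mulVec_smul, hX, mulVec_smul, hY]

/-- Up to scalars y cycles xv, xyv, xy²v; since y³ = 1 the three scalars multiply to one, so the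
third is determined by c₂ and c₁. -/
theorem IsCommutatorEigenvector.snd_fst_snd (h : IsCommutatorEigenvector p c₁ c₂ v)
    (h₁ : c₁ ≠ 0) (h₂ : c₂ ≠ 0)
    (hX : ∀ w, p.1 *ᵥ p.1 *ᵥ w = w) (hY : ∀ w, p.2 *ᵥ p.2 *ᵥ p.2 *ᵥ w = w) :
    p.2 *ᵥ p.1 *ᵥ p.2 *ᵥ v = (c₁ * c₂)⁻¹ • p.1 *ᵥ p.2 *ᵥ p.2 *ᵥ v := by
  have e1 := congrArg (p.2 *ᵥ ·) (h.snd_fst h₂ hX hY)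
  have e2 := congrArg (fun w => p.2 *ᵥ p.2 *ᵥ w) (h.snd_fst_sq hX)
  simp only [mulVec_smul, hY] at e1 e2
  rw [e2, e1, smul_smul, smul_smul, mul_assoc, inv_mul_cancel₀ (mul_ne_zero h₁ h₂), one_smul]

/-- The columns spanning the image of the six-dimensional pair. -/
def sixColumns (p : MatPair k n) (v : Fin n → k) : Fin 6 → Fin n → k :=
  ![p.1 *ᵥ v, v, p.1 *ᵥ p.2 *ᵥ v, p.2 *ᵥ v, p.1 *ᵥ p.2 *ᵥ p.2 *ᵥ v, p.2 *ᵥ p.2 *ᵥ v]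

theorem sixColumns_fst (hX : ∀ w, p.1 *ᵥ p.1 *ᵥ w = w) :
    p.1 * (Matrix.of (sixColumns p v))ᵀ =
      (Matrix.of (sixColumns p v))ᵀ * (sixPair c₁ c₂).1 := by
  refine mul_of_columns fun j => ?_
  fin_cases j <;> simp [sixColumns, sixPair, hX, -mulVec_mulVec, Fin.sum_univ_succ]

theorem sixColumns_snd (h : IsCommutatorEigenvector p c₁ c₂ v) (h₁ : c₁ ≠ 0) (h₂ : c₂ ≠ 0)
    (hX : ∀ w, p.1 *ᵥ p.1 *ᵥ w = w) (hY : ∀ w, p.2 *ᵥ p.2 *ᵥ p.2 *ᵥ w = w) :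
    p.2 * (Matrix.of (sixColumns p v))ᵀ =
      (Matrix.of (sixColumns p v))ᵀ * (sixPair c₁ c₂).2 := by
  refine mul_of_columns fun j => ?_
  fin_cases j <;>
    simp [sixColumns, sixPair, hY, h.snd_fst h₂ hX hY, h.snd_fst_snd h₁ h₂ hX hY,
      h.snd_fst_sq hX, -mulVec_mulVec, Fin.sum_univ_succ]

theorem IsCommutatorEigenvector.pairEquiv_sixPair (h : IsCommutatorEigenvector p c₁ c₂ v)
    (hp : IsIrredPair p) (hv : v ≠ 0) (h₁ : c₁ ≠ 0) (h₂ : c₂ ≠ 0)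
    (hX : ∀ w, p.1 *ᵥ p.1 *ᵥ w = w) (hY : ∀ w, p.2 *ᵥ p.2 *ᵥ p.2 *ᵥ w = w)
    (hc : ¬ IsDegenerate c₁ c₂) :
    ∃ h : 6 = n, PairEquiv p (h ▸ sixPair c₁ c₂) :=
  pairEquiv_of_intertwiner hp (sixPair_isIrredPair h₁ h₂ hc) _
    (of_columns_ne_zero (j := 1) hv) (sixColumns_fst hX) (sixColumns_snd h h₁ h₂ hX hY)

/-- A nonzero vector `v` gives an eigenvector `v + δ x v` of an involution `x`. -/
theorem exists_involution_eigenvector (hX : ∀ w, p.1 *ᵥ p.1 *ᵥ w = w) (hv : v ≠ 0) :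
    ∃ (δ : k) (w : Fin n → k), δ ^ 2 = 1 ∧ w ≠ 0 ∧ p.1 *ᵥ w = δ • w ∧
      (w = v + δ • p.1 *ᵥ v ∨ (w = v ∧ p.1 *ᵥ v = δ • v)) := by
  -- The eigenvalue -1 is used only when v + xv vanishes, so no division by two is needed and
  -- characteristic two is covered.
  by_cases h : v + p.1 *ᵥ v = 0
  · have h' : p.1 *ᵥ v = (-1 : k) • v := by
      rw [neg_one_smul]; exact eq_neg_of_add_eq_zero_right h
    exact ⟨-1, v, by norm_num, hv, h', Or.inr ⟨rfl, h'⟩⟩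
  · refine ⟨1, v + p.1 *ᵥ v, by norm_num, h, ?_, Or.inl (by simp)⟩
    rw [mulVec_add, hX, one_smul, add_comm]

/-- When c₁ and c₂ are signs, x commutes up to sign with y and y² on the span of v and xv. An
eigenvector w of x in that span therefore yields eigenvectors w, yw, y²w of x, cyclically permuted
by y. -/
theorem IsCommutatorEigenvector.pairEquiv_threePair (h : IsCommutatorEigenvector p c₁ c₂ v)
    (hp : IsIrredPair p) (hv : v ≠ 0)
    (hX : ∀ w, p.1 *ᵥ p.1 *ᵥ w = w) (hY : ∀ w, p.2 *ᵥ p.2 *ᵥ p.2 *ᵥ w = w)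
    (hc₁ : c₁ ^ 2 = 1) (hc₂ : c₂ ^ 2 = 1) (hc : ¬ (c₁ = 1 ∧ c₂ = 1)) :
    ∃ δ : k, δ ^ 2 = 1 ∧ δ ≠ -δ ∧ ∃ h : 3 = n, PairEquiv p (h ▸ threePair δ) := by
  have h₁ : c₁ ≠ 0 := by rintro rfl; simp at hc₁
  have h₂ : c₂ ≠ 0 := by rintro rfl; simp at hc₂
  -- In characteristic two the only square root of 1 is 1, which is excluded.
  have two : (2 : k) ≠ 0 := by
    intro h2
    refine hc ⟨?_, ?_⟩
    · have : (c₁ - 1) ^ 2 = 0 := by linear_combination hc₁ + (1 - c₁) * h2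
      exact sub_eq_zero.1 (pow_eq_zero_iff two_ne_zero |>.1 this)
    · have : (c₂ - 1) ^ 2 = 0 := by linear_combination hc₂ + (1 - c₂) * h2
      exact sub_eq_zero.1 (pow_eq_zero_iff two_ne_zero |>.1 this)
  have ne_neg : ∀ δ : k, δ ^ 2 = 1 → δ ≠ -δ := by
    intro δ hδ h
    have h0 : δ = 0 := by
      have : 2 * δ = 0 := by linear_combination h
      exact (mul_eq_zero.1 this).resolve_left two
    simp [h0] at hδ
  have e1 := h.snd_fst h₂ hX hY
  have e2 := h.snd_fst_snd h₁ h₂ hX hY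
  obtain ⟨δ, w, hδ, hw, hxw, hw'⟩ := exists_involution_eigenvector hX hv
  have i₂ : c₂ * c₂ = 1 := by rw [← pow_two, hc₂]
  have i₁ : c₁ * c₁ = 1 := by rw [← pow_two, hc₁]
  have iδ : δ * δ = 1 := by rw [← pow_two, hδ]
  have i12 : (c₁ * c₂)⁻¹ = c₁ * c₂ := by
    refine inv_eq_of_mul_eq_one_right ?_
    linear_combination c₂ * c₂ * i₁ + i₂
  rw [i12] at e2
  -- `f1` and `g1` say xy = c₂yx on v and xv; `f2` and `g2` say xy² = c₁y²x there.
  have f1 : p.1 *ᵥ p.2 *ᵥ v = c₂ • p.2 *ᵥ p.1 *ᵥ v := by rw [e1, smul_smul, i₂, one_smul]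
  have f2 : p.1 *ᵥ p.2 *ᵥ p.2 *ᵥ v = c₁ • p.2 *ᵥ p.2 *ᵥ p.1 *ᵥ v := by
    rw [e1, mulVec_smul, e2, smul_smul, smul_smul,
      show c₁ * c₂ * (c₁ * c₂) = 1 by linear_combination c₂ * c₂ * i₁ + i₂, one_smul]
  have g1 : p.1 *ᵥ p.2 *ᵥ p.1 *ᵥ v = c₂ • p.2 *ᵥ v := by rw [e1, mulVec_smul, hX]
  have g2 : p.1 *ᵥ p.2 *ᵥ p.2 *ᵥ p.1 *ᵥ v = c₁ • p.2 *ᵥ p.2 *ᵥ v := by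
    have := congrArg (fun w => c₁ • p.1 *ᵥ w) f2
    simp only [hX, mulVec_smul, smul_smul, i₁, one_smul] at this
    exact this.symm
  have hx1 : p.1 *ᵥ p.2 *ᵥ w = (c₂ * δ) • p.2 *ᵥ w := by
    rcases hw' with rfl | ⟨rfl, hv'⟩
    · simp only [mulVec_add, mulVec_smul, smul_add, smul_smul, f1, g1, mul_assoc, iδ, mul_one]
      rw [add_comm, mul_comm δ]
    · rw [f1, hv', mulVec_smul, smul_smul]
  have hx2 : p.1 *ᵥ p.2 *ᵥ p.2 *ᵥ w = (c₁ * δ) • p.2 *ᵥ p.2 *ᵥ w := by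
    rcases hw' with rfl | ⟨rfl, hv'⟩
    · simp only [mulVec_add, mulVec_smul, smul_add, smul_smul, f2, g2, mul_assoc, iδ, mul_one]
      rw [add_comm, mul_comm δ]
    · rw [f2, hv', mulVec_smul, mulVec_smul, smul_smul]
  have hyw : p.2 *ᵥ w ≠ 0 := fun h0 => hw (by rw [← hY w, h0]; simp)
  have hyyw : p.2 *ᵥ p.2 *ᵥ w ≠ 0 := fun h0 => hw (by rw [← hY w, h0]; simp)
  have hδ' : (-δ) ^ 2 = 1 := by rw [neg_sq, hδ]
  -- On w, yw, y²w the eigenvalues of x are δ, c₂δ, c₁δ. Exactly one differs from the other two, and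
  -- its vector is taken as the first basis vector of the model.
  rcases sq_eq_one_iff.1 hc₁ with rfl | rfl
  · rcases sq_eq_one_iff.1 hc₂ with rfl | rfl
    · exact absurd ⟨rfl, rfl⟩ hc
    · exact ⟨-δ, hδ', ne_neg _ hδ', _root_.pairEquiv_threePair hp hY hyw (ne_neg _ hδ')
        (by rw [hx1, neg_one_mul]) (by rw [hx2, one_mul, neg_neg]) (by rw [hY, hxw, neg_neg])⟩
  · rcases sq_eq_one_iff.1 hc₂ with rfl | rfl
    · exact ⟨-δ, hδ', ne_neg _ hδ', _root_.pairEquiv_threePair hp hY hyyw (ne_neg _ hδ')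
        (by rw [hx2, neg_one_mul]) (by rw [hY, hxw, neg_neg]) (by rw [hY, hx1, one_mul, neg_neg])⟩
    · exact ⟨δ, hδ, ne_neg _ hδ, _root_.pairEquiv_threePair hp hY hw (ne_neg _ hδ)
        hxw (by rw [hx1, neg_one_mul]) (by rw [hx2, neg_one_mul])⟩

/-- Here yx = c·xy on the span of v, yv, y²v, so x carries an eigenvector of y in that span to one
whose eigenvalue is multiplied by c ≠ 1. Starting from either of these two eigenvectors gives the
two orders of the diagonal. -/
theorem IsCommutatorEigenvector.pairEquiv_twoPair {c : k} (h : IsCommutatorEigenvector p c c v)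
    (hp : IsIrredPair p) (hv : v ≠ 0)
    (hX : ∀ w, p.1 *ᵥ p.1 *ᵥ w = w) (hY : ∀ w, p.2 *ᵥ p.2 *ᵥ p.2 *ᵥ w = w)
    (hc : c ^ 3 = 1) (hc1 : c ≠ 1) :
    ∃ a b : k, a ^ 3 = 1 ∧ b ^ 3 = 1 ∧ a ≠ b ∧
      (∃ h : 2 = n, PairEquiv p (h ▸ twoPair a b)) ∧
      ∃ h : 2 = n, PairEquiv p (h ▸ twoPair b a) := by
  have h₀ : c ≠ 0 := by rintro rfl; simp at hc
  have hsum : 1 + c + c ^ 2 = 0 := by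
    have : (c - 1) * (1 + c + c ^ 2) = 0 := by linear_combination hc
    exact (mul_eq_zero.1 this).resolve_left (sub_ne_zero.2 hc1)
  have three : (3 : k) ≠ 0 := by
    intro h3
    have : (c - 1) ^ 2 = 0 := by linear_combination hsum - c * h3
    exact hc1 (sub_eq_zero.1 (pow_eq_zero_iff two_ne_zero |>.1 this))
  have hinv : (c * c)⁻¹ = c := by
    refine inv_eq_of_mul_eq_one_right ?_
    linear_combination hc
  have e1 := h.snd_fst h₀ hX hY
  have e2 := h.snd_fst_snd h₀ h₀ hX hY
  have e3 := h.snd_fst_sq hX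
  rw [hinv] at e2
  -- The three candidates for t = 1, c, c² add up to 3v ≠ 0, so they cannot all vanish.
  obtain ⟨t, ht, hw⟩ : ∃ t : k, t ^ 3 = 1 ∧
      v + t • p.2 *ᵥ v + t ^ 2 • p.2 *ᵥ p.2 *ᵥ v ≠ 0 := by
    by_contra! hall
    have a0 := hall 1 (by simp)
    have a1 := hall c hc
    have a2 := hall (c ^ 2) (by linear_combination (c ^ 3 + 1) * hc)
    refine hv ((smul_eq_zero.1 (?_ : (3 : k) • v = 0)).resolve_left three)
    have hc4 : (c ^ 2) ^ 2 = c := by linear_combination c * hc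
    rw [hc4] at a2
    calc (3 : k) • v = (v + (1 : k) • p.2 *ᵥ v + (1 : k) ^ 2 • p.2 *ᵥ p.2 *ᵥ v) +
          (v + c • p.2 *ᵥ v + c ^ 2 • p.2 *ᵥ p.2 *ᵥ v) +
          (v + c ^ 2 • p.2 *ᵥ v + c • p.2 *ᵥ p.2 *ᵥ v) -
          (1 + c + c ^ 2) • (p.2 *ᵥ v + p.2 *ᵥ p.2 *ᵥ v) := by module
      _ = 0 := by rw [a0, a1, a2, hsum]; simp
  set w := v + t • p.2 *ᵥ v + t ^ 2 • p.2 *ᵥ p.2 *ᵥ v with hwdef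
  have hyw : p.2 *ᵥ w = t ^ 2 • w := by
    have t4 : t ^ 2 * t ^ 2 = t := by linear_combination t * ht
    have t3 : t ^ 2 * t = 1 := by linear_combination ht
    simp only [hwdef, mulVec_add, mulVec_smul, smul_add, smul_smul, hY, t3, t4, one_smul]
    abel
  have hyxw : p.2 *ᵥ p.1 *ᵥ w = (c * t ^ 2) • p.1 *ᵥ w := by
    have t4 : c * t ^ 2 * t ^ 2 = c * t := by linear_combination c * t * ht
    have t3 : c * t ^ 2 * t = c := by linear_combination c * ht
    simp only [hwdef, mulVec_add, mulVec_smul, smul_add, smul_smul, e1, e2, e3, t3, t4]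
    rw [mul_comm t c, mul_comm (t ^ 2) c]
    abel
  have ht0 : t ≠ 0 := by rintro rfl; simp at ht
  have hne : t ^ 2 ≠ c * t ^ 2 := by
    intro heq
    have : (c - 1) * t ^ 2 = 0 := by linear_combination -heq
    exact (mul_ne_zero (sub_ne_zero.2 hc1) (pow_ne_zero 2 ht0)) this
  have hxw : p.1 *ᵥ w ≠ 0 := fun h0 => hw (by rw [← hX w, h0]; simp)
  refine ⟨t ^ 2, c * t ^ 2, by linear_combination (t ^ 3 + 1) * ht,
    by linear_combination t ^ 6 * hc + (t ^ 3 + 1) * ht, hne,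
    _root_.pairEquiv_twoPair hp hX hw hne hyw hyxw,
    _root_.pairEquiv_twoPair hp hX hxw hne.symm hyxw (by rw [hX, hyw])⟩

/-- The vectors on which x commutes with both y and y² form a stable subspace. It contains v, so x
and y commute everywhere and share an eigenvector. -/
theorem IsCommutatorEigenvector.pairEquiv_onePair [IsAlgClosed k]
    (h : IsCommutatorEigenvector p 1 1 v) (hp : IsIrredPair p) (hv : v ≠ 0)
    (hX : ∀ w, p.1 *ᵥ p.1 *ᵥ w = w) (hY : ∀ w, p.2 *ᵥ p.2 *ᵥ p.2 *ᵥ w = w) :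
    ∃ d e : k, d ^ 2 = 1 ∧ e ^ 3 = 1 ∧ ∃ h : 1 = n, PairEquiv p (h ▸ onePair d e) := by
  let W : Submodule k (Fin n → k) :=
    { carrier := {w | p.1 *ᵥ p.2 *ᵥ w = p.2 *ᵥ p.1 *ᵥ w ∧
        p.1 *ᵥ p.2 *ᵥ p.2 *ᵥ w = p.2 *ᵥ p.2 *ᵥ p.1 *ᵥ w}
      add_mem' := by
        rintro a b ⟨ha, ha'⟩ ⟨hb, hb'⟩
        simp only [Set.mem_ofPred_eq, mulVec_add, ha, ha', hb, hb', and_self]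
      zero_mem' := by simp
      smul_mem' := by
        rintro t a ⟨ha, ha'⟩
        simp only [Set.mem_ofPred_eq, mulVec_smul, ha, ha', and_self] }
  have hW : W = ⊤ := by
    refine (hp.2 W ?_ ?_).resolve_left ?_
    · rintro w ⟨ha, hb⟩
      exact ⟨by rw [← ha, hX, hX], by rw [← hb, hX, hX]⟩
    · rintro w ⟨ha, hb⟩
      exact ⟨by rw [hb, ha], by rw [hY, ha, hY]⟩
    · rw [← ne_eq, Submodule.ne_bot_iff]
      have e3 := h.snd_fst_sq hX
      refine ⟨v, ⟨?_, ?_⟩, hv⟩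
      · rw [h.snd_fst one_ne_zero hX hY, one_smul]
      · rw [one_smul] at e3
        rw [← e3, hY]
  have hcomm : ∀ w, p.1 *ᵥ p.2 *ᵥ w = p.2 *ᵥ p.1 *ᵥ w := fun w =>
    (show w ∈ W from hW ▸ Submodule.mem_top).1
  have : NeZero n := ⟨hp.1⟩
  obtain ⟨e, he⟩ := Module.End.exists_eigenvalue p.2.mulVecLin
  obtain ⟨u, hu⟩ := he.exists_hasEigenvector
  have hue : p.2 *ᵥ u = e • u := hu.apply_eq_smul
  obtain ⟨d, w, hd, hw, hxw, hw'⟩ := exists_involution_eigenvector hX hu.2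
  have hyw : p.2 *ᵥ w = e • w := by
    rcases hw' with rfl | ⟨rfl, -⟩
    · rw [mulVec_add, mulVec_smul, ← hcomm, hue, mulVec_smul, smul_add, smul_comm]
    · exact hue
  refine ⟨d, e, hd, ?_, _root_.pairEquiv_onePair hp hw hxw hyw⟩
  have h3 := hY w
  simp only [hyw, mulVec_smul, smul_smul] at h3
  have : (e ^ 3 - 1) • w = 0 := by
    rw [sub_smul, one_smul, sub_eq_zero]
    conv_rhs => rw [← h3]
    congr 1; ring
  exact sub_eq_zero.1 ((smul_eq_zero.1 this).resolve_right hw)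

end

/-! ### Admissible representations reduce to the models. -/

theorem PairEquiv.symm {n : ℕ} {p q : MatPair k n} (h : PairEquiv p q) : PairEquiv q p := by
  obtain ⟨Q, h1, h2⟩ := h
  refine ⟨Q⁻¹, ?_, ?_⟩
  · rw [h1]; simp [mul_assoc]
  · rw [h2]; simp [mul_assoc]

theorem PairEquiv.trace_eq {n : ℕ} {p q : MatPair k n} (h : PairEquiv p q) :
    p.1.trace = q.1.trace ∧ p.2.trace = q.2.trace := by
  obtain ⟨Q, h1, h2⟩ := h
  rw [h1, h2]
  exact ⟨Matrix.trace_units_conj Q _, Matrix.trace_units_conj Q _⟩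

theorem genPair_fst_mulVec {n : ℕ} (ρ : ModGroup →* GL (Fin n) k) (w : Fin n → k) :
    (genPair ρ).1 *ᵥ (genPair ρ).1 *ᵥ w = w := by
  rw [mulVec_mulVec, genPair, ← Units.val_mul, ← map_mul, ← pow_two, genX_sq]
  simp

theorem genPair_snd_mulVec {n : ℕ} (ρ : ModGroup →* GL (Fin n) k) (w : Fin n → k) :
    (genPair ρ).2 *ᵥ (genPair ρ).2 *ᵥ (genPair ρ).2 *ᵥ w = w := by
  rw [mulVec_mulVec, mulVec_mulVec, genPair, ← Units.val_mul, ← map_mul, ← Units.val_mul,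
    ← map_mul, ← pow_two, ← pow_succ, genY_cube]
  simp

theorem diag_apply_ne_zero {n : ℕ} (g : GL (Fin n) k)
    (hg : (g : Matrix (Fin n) (Fin n) k).IsDiag) (i : Fin n) :
    (g : Matrix (Fin n) (Fin n) k) i i ≠ 0 := by
  intro h
  have hv : (g : Matrix (Fin n) (Fin n) k) *ᵥ Pi.single i 1 = 0 := by
    ext j
    rw [mulVec_single_one]
    by_cases hj : j = i
    · subst hj; exact h
    · exact hg hj
  have := congrArg (fun w => ((g⁻¹ : GL (Fin n) k) : Matrix (Fin n) (Fin n) k) *ᵥ w) hv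
  simp only [mulVec_mulVec, ← Units.val_mul, inv_mul_cancel, Units.val_one, one_mulVec,
    mulVec_zero] at this
  simpa using congrFun this i

/-- Both commutators act by invertible diagonal matrices, so any standard basis vector works; one
exists because irreducibility forces n ≠ 0. -/
theorem exists_isCommutatorEigenvector {n : ℕ} {ρ : ModGroup →* GL (Fin n) k}
    (hρ : IsIrredDiag ρ) : ∃ (c₁ c₂ : k) (v : Fin n → k), c₁ ≠ 0 ∧ c₂ ≠ 0 ∧ v ≠ 0 ∧
      IsCommutatorEigenvector (genPair ρ) c₁ c₂ v := by
  have hp := (columnRep_isIrreducible_iff ρ).1 hρ.1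
  let i : Fin n := ⟨0, Nat.pos_of_ne_zero hp.1⟩
  have hX : genX⁻¹ = genX := by rw [inv_eq_iff_mul_eq_one, ← pow_two, genX_sq]
  have hY : genY⁻¹ = genY * genY := by
    rw [inv_eq_iff_mul_eq_one, ← pow_two, ← pow_succ', genY_cube]
  have ha : genX * genY * genX * (genY * genY) ∈ commutator ModGroup := by
    have := Subgroup.commutator_mem_commutator (Subgroup.mem_top genX) (Subgroup.mem_top genY)
    rwa [commutatorElement_def, hX, hY] at this
  have hb : genX * (genY * genY) * genX * genY ∈ commutator ModGroup := by
    have := Subgroup.commutator_mem_commutator (Subgroup.mem_top genX)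
      (Subgroup.mem_top genY⁻¹)
    rwa [commutatorElement_def, inv_inv, hX, hY] at this
  have eig : ∀ g ∈ commutator ModGroup, (ρ g : Matrix (Fin n) (Fin n) k) *ᵥ Pi.single i 1 =
      (ρ g : Matrix (Fin n) (Fin n) k) i i • Pi.single i 1 := by
    intro g hg
    ext j
    rw [mulVec_single_one]
    by_cases hj : j = i
    · subst hj; simp
    · simpa [hj] using hρ.2 g hg hj
  refine ⟨_, _, Pi.single i 1, diag_apply_ne_zero _ (hρ.2 _ ha) i,
    inv_ne_zero (diag_apply_ne_zero _ (hρ.2 _ hb) i), by simp, ⟨?_, ?_⟩⟩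
  · rw [← eig _ ha]
    simp only [genPair, mulVec_mulVec, map_mul, Units.val_mul, mul_assoc]
  · rw [inv_inv, ← eig _ hb]
    simp only [genPair, mulVec_mulVec, map_mul, Units.val_mul, mul_assoc]

theorem pairEquiv_cases [IsAlgClosed k] {n : ℕ} {ρ : ModGroup →* GL (Fin n) k}
    (hρ : IsIrredDiag ρ) :
    (∃ d e : k, d ^ 2 = 1 ∧ e ^ 3 = 1 ∧ ∃ h : 1 = n, PairEquiv (genPair ρ) (h ▸ onePair d e)) ∨
    (∃ a b : k, a ^ 3 = 1 ∧ b ^ 3 = 1 ∧ a ≠ b ∧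
      (∃ h : 2 = n, PairEquiv (genPair ρ) (h ▸ twoPair a b)) ∧
      ∃ h : 2 = n, PairEquiv (genPair ρ) (h ▸ twoPair b a)) ∨
    (∃ δ : k, δ ^ 2 = 1 ∧ δ ≠ -δ ∧ ∃ h : 3 = n, PairEquiv (genPair ρ) (h ▸ threePair δ)) ∨
    ∃ c₁ c₂ : k, c₁ ≠ 0 ∧ c₂ ≠ 0 ∧ ¬ IsDegenerate c₁ c₂ ∧
      ∃ h : 6 = n, PairEquiv (genPair ρ) (h ▸ sixPair c₁ c₂) := by
  have hp := (columnRep_isIrreducible_iff ρ).1 hρ.1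
  have hX := genPair_fst_mulVec ρ
  have hY := genPair_snd_mulVec ρ
  obtain ⟨c₁, c₂, v, h₁, h₂, hv, h⟩ := exists_isCommutatorEigenvector hρ
  by_cases hc : IsDegenerate c₁ c₂
  -- The point (1,1) satisfies both degeneracy conditions, so it is split off first.
  · by_cases hone : c₁ = 1 ∧ c₂ = 1
    · obtain ⟨rfl, rfl⟩ := hone
      exact Or.inl (h.pairEquiv_onePair hp hv hX hY)
    · rcases hc with ⟨hc₁, hc₂⟩ | ⟨rfl, hc⟩
      · exact Or.inr (Or.inr (Or.inl (h.pairEquiv_threePair hp hv hX hY hc₁ hc₂ hone)))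
      · exact Or.inr (Or.inl (h.pairEquiv_twoPair hp hv hX hY hc (by simpa using hone)))
  · exact Or.inr (Or.inr (Or.inr ⟨c₁, c₂, h₁, h₂, hc,
      h.pairEquiv_sixPair hp hv h₁ h₂ hX hY hc⟩))

/-! ### Equivalence inside the six-dimensional family. -/

/-- The i-th basis vector is a commutator eigenvector with parameters d₁, d₂, so its six translates
intertwine the two pairs. Only the target has to be known irreducible, which avoids checking that
(d₁, d₂) is nondegenerate. -/
theorem pairEquiv_sixPair_of_characters {c₁ c₂ d₁ d₂ : k} (h₁ : c₁ ≠ 0) (h₂ : c₂ ≠ 0)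
    (hd₁ : d₁ ≠ 0) (hd₂ : d₂ ≠ 0) (hc : ¬ IsDegenerate c₁ c₂) (i : Fin 6)
    (ha : ![1 / c₁, c₁, 1 / c₂, c₂, c₁ * c₂, 1 / (c₁ * c₂)] i = d₁)
    (hb : ![c₂, 1 / c₂, 1 / (c₁ * c₂), c₁ * c₂, c₁, 1 / c₁] i = d₂⁻¹) :
    PairEquiv (sixPair d₁ d₂) (sixPair c₁ c₂) := by
  have hv : (Pi.single i 1 : Fin 6 → k) ≠ 0 := by simp
  have single : ∀ (d : Fin 6 → k), d * Pi.single i 1 = d i • (Pi.single i 1 : Fin 6 → k) := by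
    intro d
    ext j
    by_cases hj : j = i
    · subst hj; simp
    · simp [hj]
  have h : IsCommutatorEigenvector (sixPair c₁ c₂) d₁ d₂ (Pi.single i 1) :=
    ⟨by rw [sixPair_commutator_fst h₁ h₂, single, ha],
      by rw [sixPair_commutator_snd h₁ h₂, single, hb]⟩
  have hX : ∀ w, (sixPair c₁ c₂).1 *ᵥ (sixPair c₁ c₂).1 *ᵥ w = w := fun w => by
    rw [mulVec_mulVec, sixPair_fst_sq, one_mulVec]
  have hY : ∀ w, (sixPair c₁ c₂).2 *ᵥ (sixPair c₁ c₂).2 *ᵥ (sixPair c₁ c₂).2 *ᵥ w = w :=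
    fun w => by
      rw [mulVec_mulVec, mulVec_mulVec, sixPair_snd_cube h₁ h₂, one_mulVec]
  obtain ⟨_, hQ⟩ := pairEquiv_of_intertwiner_of_le (q := sixPair d₁ d₂)
    (sixPair_isIrredPair h₁ h₂ hc) le_rfl _
    (of_columns_ne_zero (j := 1) hv) (sixColumns_fst hX) (sixColumns_snd h hd₁ hd₂ hX hY)
  exact PairEquiv.symm hQ

/-- The basis vector of index 1 has character (d₁, 1/d₂). Its image under `Q` is a joint eigenvector
of diagonal matrices, and any nonzero coordinate i of the image reads off the same character. -/
theorem characters_of_pairEquiv_sixPair {c₁ c₂ d₁ d₂ : k} (h₁ : c₁ ≠ 0) (h₂ : c₂ ≠ 0)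
    (hd₁ : d₁ ≠ 0) (hd₂ : d₂ ≠ 0) (h : PairEquiv (sixPair d₁ d₂) (sixPair c₁ c₂)) :
    ∃ i, ![1 / c₁, c₁, 1 / c₂, c₂, c₁ * c₂, 1 / (c₁ * c₂)] i = d₁ ∧
      ![c₂, 1 / c₂, 1 / (c₁ * c₂), c₁ * c₂, c₁, 1 / c₁] i = 1 / d₂ := by
  obtain ⟨Q, hQ1, hQ2⟩ := h.symm
  set X := (sixPair d₁ d₂).1
  set Y := (sixPair d₁ d₂).2
  have hx : ∀ w, (sixPair c₁ c₂).1 *ᵥ (Q : Matrix (Fin 6) (Fin 6) k) *ᵥ w =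
      (Q : Matrix (Fin 6) (Fin 6) k) *ᵥ X *ᵥ w := fun w => by
    rw [hQ1]; simp [mul_assoc]
  have hy : ∀ w, (sixPair c₁ c₂).2 *ᵥ (Q : Matrix (Fin 6) (Fin 6) k) *ᵥ w =
      (Q : Matrix (Fin 6) (Fin 6) k) *ᵥ Y *ᵥ w := fun w => by
    rw [hQ2]; simp [mul_assoc]
  have ha := sixPair_commutator_fst h₁ h₂
    ((Q : Matrix (Fin 6) (Fin 6) k) *ᵥ Pi.single 1 1)
  have hb := sixPair_commutator_snd h₁ h₂
    ((Q : Matrix (Fin 6) (Fin 6) k) *ᵥ Pi.single 1 1)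
  simp only [hx, hy] at ha hb
  rw [sixPair_commutator_fst hd₁ hd₂] at ha
  rw [sixPair_commutator_snd hd₁ hd₂] at hb
  have e1 : ![1 / d₁, d₁, 1 / d₂, d₂, d₁ * d₂, 1 / (d₁ * d₂)] * Pi.single 1 1 =
      d₁ • (Pi.single 1 1 : Fin 6 → k) := by
    ext j; fin_cases j <;> simp
  have e2 : ![d₂, 1 / d₂, 1 / (d₁ * d₂), d₁ * d₂, d₁, 1 / d₁] * Pi.single 1 1 =
      (1 / d₂) • (Pi.single 1 1 : Fin 6 → k) := by
    ext j; fin_cases j <;> simp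
  rw [e1, mulVec_smul] at ha
  rw [e2, mulVec_smul] at hb
  have hu : (Q : Matrix (Fin 6) (Fin 6) k) *ᵥ Pi.single 1 1 ≠ 0 := by
    intro h0
    have := congrArg (fun w => ((Q⁻¹ : GL (Fin 6) k) : Matrix (Fin 6) (Fin 6) k) *ᵥ w) h0
    simp only [mulVec_mulVec, ← Units.val_mul, inv_mul_cancel, Units.val_one, one_mulVec,
      mulVec_zero] at this
    simpa using congrFun this 1
  obtain ⟨i, hi⟩ := Function.ne_iff.1 hu
  refine ⟨i, ?_, ?_⟩
  · exact (mul_right_cancel₀ hi (congrFun ha i)).symm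
  · exact (mul_right_cancel₀ hi (congrFun hb i)).symm

theorem sixPair_pairEquiv_iff {c : k × k} (h₁ : c.1 ≠ 0) (h₂ : c.2 ≠ 0)
    (hc : ¬ IsDegenerate c.1 c.2) {d : k × k} (hd₁ : d.1 ≠ 0) (hd₂ : d.2 ≠ 0) :
    PairEquiv (sixPair d.1 d.2) (sixPair c.1 c.2) ↔ d ∈ paramOrbit c.1 c.2 := by
  obtain ⟨c₁, c₂⟩ := c
  obtain ⟨d₁, d₂⟩ := d
  simp only at h₁ h₂ hc hd₁ hd₂ ⊢
  simp only [paramOrbit, Set.mem_insert_iff, Set.mem_singleton_iff, Prod.mk.injEq]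
  constructor
  · intro h
    obtain ⟨i, ha, hb⟩ := characters_of_pairEquiv_sixPair h₁ h₂ hd₁ hd₂ h
    have hb' : d₂ = (![c₂, 1 / c₂, 1 / (c₁ * c₂), c₁ * c₂, c₁, 1 / c₁] i)⁻¹ := by
      rw [hb, one_div, inv_inv]
    subst ha hb'
    fin_cases i <;> simp
  · rintro (⟨rfl, rfl⟩ | ⟨rfl, rfl⟩ | ⟨rfl, rfl⟩ | ⟨rfl, rfl⟩ | ⟨rfl, rfl⟩ | ⟨rfl, rfl⟩)
    · exact pairEquiv_sixPair_of_characters h₁ h₂ hd₁ hd₂ hc 1 (by simp) (by simp)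
    · exact pairEquiv_sixPair_of_characters h₁ h₂ hd₁ hd₂ hc 0 (by simp) (by simp)
    · exact pairEquiv_sixPair_of_characters h₁ h₂ hd₁ hd₂ hc 3 (by simp) (by simp)
    · exact pairEquiv_sixPair_of_characters h₁ h₂ hd₁ hd₂ hc 2 (by simp) (by simp)
    · exact pairEquiv_sixPair_of_characters h₁ h₂ hd₁ hd₂ hc 5 (by simp) (by simp)
    · exact pairEquiv_sixPair_of_characters h₁ h₂ hd₁ hd₂ hc 4 (by simp) (by simp)

/-! ### Assembling the classification in each characteristic. -/

/-- The classification, for any list of small pairs and any set of excluded parameters that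
describe the roots of unity involved. -/
theorem isClassification_of_lists [IsAlgClosed k] {small : (n : ℕ) → List (MatPair k n)}
    {excl : Set (k × k)}
    (hexcl : ∀ c₁ c₂ : k, (c₁, c₂) ∈ excl ↔ IsDegenerate c₁ c₂)
    (one : ∀ p, p ∈ small 1 ↔ ∃ d e : k, d ^ 2 = 1 ∧ e ^ 3 = 1 ∧ p = onePair d e)
    (two : ∀ p ∈ small 2, ∃ a b : k, a ^ 3 = 1 ∧ b ^ 3 = 1 ∧ a ≠ b ∧ p = twoPair a b)
    (two' : ∀ a b : k, a ^ 3 = 1 → b ^ 3 = 1 → a ≠ b →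
      twoPair a b ∈ small 2 ∨ twoPair b a ∈ small 2)
    (three : ∀ p, p ∈ small 3 ↔ ∃ δ : k, δ ^ 2 = 1 ∧ δ ≠ -δ ∧ p = threePair δ)
    (other : ∀ n, n ≠ 1 → n ≠ 2 → n ≠ 3 → small n = [])
    (distinct : ∀ n < 6, (small n).Pairwise fun p q =>
      ¬ (p.1.trace = q.1.trace ∧ p.2.trace = q.2.trace)) :
    IsClassification small excl where
  complete n ρ hρ := by
    rcases pairEquiv_cases hρ with ⟨d, e, hd, he, rfl, h⟩ | ⟨a, b, ha, hb, hab, ⟨rfl, h⟩, ⟨_, h'⟩⟩ |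
      ⟨δ, hδ, hδ', rfl, h⟩ | ⟨c₁, c₂, h₁, h₂, hc, rfl, h⟩
    · exact ⟨_, Or.inl ((one _).2 ⟨d, e, hd, he, rfl⟩), h⟩
    -- The lists contain only one order of each diagonal {a, b}; whichever it is, the matching
    -- equivalence is at hand.
    · rcases two' a b ha hb hab with hm | hm
      exacts [⟨_, Or.inl hm, h⟩, ⟨_, Or.inl hm, h'⟩]
    · exact ⟨_, Or.inl ((three _).2 ⟨δ, hδ, hδ', rfl⟩), h⟩
    · exact ⟨_, Or.inr ⟨(c₁, c₂), ⟨h₁, h₂, fun hm => hc ((hexcl _ _).1 hm)⟩, rfl⟩, h⟩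
  realized n p hp := by
    rcases hp with hp | hp
    · by_cases h1 : n = 1
      · subst h1
        obtain ⟨d, e, hd, he, rfl⟩ := (one p).1 hp
        exact onePair_realized hd he
      by_cases h2 : n = 2
      · subst h2
        obtain ⟨a, b, ha, hb, hab, rfl⟩ := two p hp
        exact twoPair_realized ha hb hab
      by_cases h3 : n = 3
      · subst h3
        obtain ⟨δ, hδ, hδ', rfl⟩ := (three p).1 hp
        exact threePair_realized hδ hδ'
      simp [other n h1 h2 h3] at hp
    · by_cases h6 : n = 6
      · subst h6
        obtain ⟨c, ⟨h₁, h₂, hc⟩, rfl⟩ := hp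
        exact sixPair_realized h₁ h₂ fun hd => hc ((hexcl _ _).2 hd)
      · unfold sixFamily at hp
        split at hp
        · exact absurd rfl h6
        · exact absurd hp (Set.notMem_empty _)
  small_distinct n hn := (distinct n hn).imp fun h he => h he.trace_eq
  six_equiv_iff := by
    rintro c ⟨h₁, h₂, hc⟩ d hd₁ hd₂
    exact sixPair_pairEquiv_iff h₁ h₂ (fun hd => hc ((hexcl _ _).2 hd)) hd₁ hd₂

theorem cube_eq_one_iff_of_isPrimitiveRoot {ζ : k} (hζ : IsPrimitiveRoot ζ 3) (c : k) :
    c ^ 3 = 1 ↔ c = 1 ∨ c = ζ ∨ c = ζ ^ 2 := by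
  have h3 := hζ.pow_eq_one
  have h1 : ζ ≠ 1 := hζ.ne_one (by norm_num)
  have hsum : 1 + ζ + ζ ^ 2 = 0 := by
    have : (ζ - 1) * (1 + ζ + ζ ^ 2) = 0 := by linear_combination h3
    exact (mul_eq_zero.1 this).resolve_left (sub_ne_zero.2 h1)
  constructor
  · intro hc
    have : (c - 1) * ((c - ζ) * (c - ζ ^ 2)) = 0 := by
      linear_combination hc - h3 - (c ^ 2 - c * ζ) * hsum
    simpa [sub_eq_zero] using this
  · rintro (rfl | rfl | rfl)
    · simp
    · exact h3
    · linear_combination (ζ ^ 3 + 1) * h3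

theorem neg_threePair_one :
    (-!![1, 0, 0; 0, -1, 0; 0, 0, -1], !![0, 1, 0; 0, 0, 1; 1, 0, 0]) = threePair (-1 : k) := by
  refine Prod.ext ?_ rfl
  ext i j
  fin_cases i <;> fin_cases j <;> simp [threePair]

end

theorem theorem4p1 {k : Type*} [Field k] [IsAlgClosed k] (ζ : k)
    (hζ : ringChar k ≠ 3 → IsPrimitiveRoot ζ 3) :
    (ringChar k ≠ 2 → ringChar k ≠ 3 →
      IsClassification (smallListGeneric ζ)
        {(1, 1), (-1, 1), (1, -1), (-1, -1), (ζ, ζ), (ζ ^ 2, ζ ^ 2)}) ∧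
    (ringChar k = 2 →
      IsClassification (smallListCharTwo ζ) {(1, 1), (ζ, ζ), (ζ ^ 2, ζ ^ 2)}) ∧
    (ringChar k = 3 →
      IsClassification (smallListCharThree (k := k)) {(1, 1), (-1, 1), (1, -1), (-1, -1)}) := by
  have prim : ringChar k ≠ 3 → (∀ c : k, c ^ 3 = 1 ↔ c = 1 ∨ c = ζ ∨ c = ζ ^ 2) ∧
      ζ ≠ 1 ∧ ζ ^ 2 ≠ 1 ∧ ζ ≠ ζ ^ 2 := by
    intro h
    have h1 : ζ ≠ 1 := (hζ h).ne_one (by norm_num)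
    have h2 : ζ ^ 2 ≠ 1 := (hζ h).pow_ne_one_of_pos_of_lt two_ne_zero (by norm_num)
    refine ⟨cube_eq_one_iff_of_isPrimitiveRoot (hζ h), h1, h2, fun he => ?_⟩
    have h0 : ζ ≠ 0 := (hζ h).ne_zero three_ne_zero
    exact h1 (mul_left_cancel₀ h0 (by linear_combination -he))
  have sq : ∀ c : k, c ^ 2 = 1 ↔ c = 1 ∨ c = -1 := fun c => sq_eq_one_iff
  have three (h2 : ringChar k ≠ 2) (p : MatPair k 3) :
      p ∈ [(!![1, 0, 0; 0, -1, 0; 0, 0, -1], !![0, 1, 0; 0, 0, 1; 1, 0, 0]),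
        (-!![1, 0, 0; 0, -1, 0; 0, 0, -1], !![0, 1, 0; 0, 0, 1; 1, 0, 0])] ↔
      ∃ δ : k, δ ^ 2 = 1 ∧ δ ≠ -δ ∧ p = threePair δ := by
    have hne : (1 : k) ≠ -1 := (Ring.neg_one_ne_one_of_char_ne_two h2).symm
    rw [neg_threePair_one]
    simp only [List.mem_cons, List.not_mem_nil, or_false]
    constructor
    · rintro (rfl | rfl)
      · exact ⟨1, by simp, hne, rfl⟩
      · exact ⟨-1, by simp, by simpa using hne.symm, rfl⟩
    · rintro ⟨δ, hδ, -, rfl⟩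
      rcases (sq δ).1 hδ with rfl | rfl
      exacts [Or.inl rfl, Or.inr rfl]
  refine ⟨fun hc2 hc3 => ?_, fun hc2 => ?_, fun hc3 => ?_⟩
  · obtain ⟨cube, z1, z2, z3⟩ := prim hc3
    have hne : (1 : k) ≠ -1 := (Ring.neg_one_ne_one_of_char_ne_two hc2).symm
    refine isClassification_of_lists ?_ ?_ ?_ ?_ (three hc2) ?_ ?_
    · intro c₁ c₂
      simp only [Set.mem_insert_iff, Set.mem_singleton_iff, Prod.mk.injEq, IsDegenerate, sq, cube]
      grind
    · intro p
      simp only [smallListGeneric, List.mem_cons, List.not_mem_nil, or_false, sq, cube, onePair,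
        or_and_right, exists_or, exists_and_left, exists_eq_left]
      tauto
    · intro p hp
      simp only [smallListGeneric, List.mem_cons, List.not_mem_nil, or_false] at hp
      simp only [cube, twoPair]
      grind
    · intro a b
      simp only [smallListGeneric, List.mem_cons, List.not_mem_nil, or_false, cube, twoPair]
      grind
    · intro n h1 h2 h3
      unfold smallListGeneric
      split <;> simp_all
    · intro n hn
      interval_cases n <;> simp [smallListGeneric, trace_fin_two, trace_fin_three] <;> grind
  · obtain ⟨cube, z1, z2, z3⟩ := prim (by omega)
    have : CharP k 2 := ringChar.of_eq hc2
    have hneg : (-1 : k) = 1 := CharTwo.neg_eq 1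
    have hself : ∀ δ : k, -δ = δ := CharTwo.neg_eq
    refine isClassification_of_lists ?_ ?_ ?_ ?_ ?_ ?_ ?_
    · intro c₁ c₂
      simp only [Set.mem_insert_iff, Set.mem_singleton_iff, Prod.mk.injEq, IsDegenerate, sq, cube,
        hneg]
      grind
    · intro p
      simp only [smallListCharTwo, List.mem_cons, List.not_mem_nil, or_false, sq, cube, onePair,
        hneg, or_and_right, exists_or, exists_and_left, exists_eq_left]
      tauto
    · intro p hp
      simp only [smallListCharTwo, List.mem_cons, List.not_mem_nil, or_false] at hp
      simp only [cube, twoPair]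
      grind
    · intro a b
      simp only [smallListCharTwo, List.mem_cons, List.not_mem_nil, or_false, cube, twoPair]
      grind
    -- In characteristic two no δ differs from -δ, so there is no three-dimensional model.
    · intro p
      simp [smallListCharTwo, hself]
    · intro n h1 h2 h3
      unfold smallListCharTwo
      split <;> simp_all
    · intro n hn
      interval_cases n <;> simp [smallListCharTwo, trace_fin_two] <;> grind
  · have hc2 : ringChar k ≠ 2 := by omega
    have hne : (1 : k) ≠ -1 := (Ring.neg_one_ne_one_of_char_ne_two hc2).symm
    have : CharP k 3 := ringChar.of_eq hc3
    have h3 : (3 : k) = 0 := by exact_mod_cast CharP.cast_eq_zero k 3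
    -- In characteristic three c³ - 1 = (c - 1)³, so 1 is the only cube root of unity and
    -- two-dimensional models disappear.
    have cube : ∀ c : k, c ^ 3 = 1 ↔ c = 1 := fun c => by
      refine ⟨fun h => ?_, fun h => by simp [h]⟩
      have : (c - 1) ^ 3 = 0 := by linear_combination h + (c - c ^ 2) * h3
      exact sub_eq_zero.1 (pow_eq_zero_iff three_ne_zero |>.1 this)
    refine isClassification_of_lists ?_ ?_ ?_ ?_ (three hc2) ?_ ?_
    · intro c₁ c₂
      simp only [Set.mem_insert_iff, Set.mem_singleton_iff, Prod.mk.injEq, IsDegenerate, sq, cube]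
      grind
    · intro p
      simp only [smallListCharThree, List.mem_cons, List.not_mem_nil, or_false, sq, cube, onePair,
        or_and_right, exists_or, exists_and_left, exists_eq_left]
    · simp [smallListCharThree]
    · intro a b ha hb hab
      exact absurd (((cube a).1 ha).trans ((cube b).1 hb).symm) hab
    · intro n h1 h2 h3
      unfold smallListCharThree
      split <;> simp_all
    · intro n hn
      interval_cases n <;> simp [smallListCharThree, trace_fin_three] <;> grind
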